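/- Let $\mathbb T=\mathbb R/2\pi\mathbb Z$ with arc length distance $d$ and uniform probability measure $\lambda$, and let $p\ge 1$. Then there is a constant $\sigma(p)\in(0,1/2)$ depending only on $p$, and for every $A>0$ a constant $C(A,p)>0$ depending only on $A$ and $p$, such that the following holds. Let $a\in(0,1]$ and let $\nu$ be a probability measure on $\mathbb T$ that has a density, still denoted $\nu$, with respect to $\lambda$ satisfying $|\nu(y)-\nu(x)|\le A\,d(x,y)^a$ for all $x,y\in\mathbb T$. Put $$U_p(x)=\int d(x,y)^p\,\nu(dy),\qquad \mu_\beta(dx)=\frac{e^{-\beta U_p(x)}\lambda(dx)}{\int e^{-\beta U_p}\,d\lambda},\qquad a(p)=\begin{cases}\min(a,p-1)&\text{if }1<p<2,\\ a&\text{if } p=1\text{ or }p\ge 2.\end{cases}$$ For $\alpha>0$ and $\beta\geq 0$ let $L_{\alpha,\beta}$ be the operator, with domain $C^2(\mathbb T)$ in $L^2(\mu_\beta)$, $$L_{\alpha,\beta}f(x)=\tfrac12 f''(x)+\frac1\alpha\int \Big(f\big(\gamma(x,y,\tfrac p2\beta\alpha\, d(x,y)^{p-1})\big)-f(x)\Big)\,\nu(dy),$$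 where $t\mapsto\gamma(x,y,t)$ is the minimal unit speed geodesic with $\gamma(x,y,0)=x$ leading from $x$ to $y$ (the anti-clockwise one if $y=x+\pi$), and let $L^*_{\alpha,\beta}$ be its adjoint in $L^2(\mu_\beta)$. Then for all $\alpha>0$ and $\beta>1$ with $\alpha\beta^2<\sigma(p)$, the constant function $\mathbb 1$ belongs to the domain of $L^*_{\alpha,\beta}$ and $$\sqrt{\mu_\beta\big[(L^*_{\alpha,\beta}\mathbb 1)^2\big]}\le C(A,p)\,\alpha^{a(p)}\,\beta^4 .$$ -/

import Mathlib

open MeasureTheory Set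

namespace CircleMeans

noncomputable section

/-- The circle `ℝ / 2πℤ`. Its distance is the arc length distance `d`. -/
abbrev Torus : Type := AddCircle (2 * Real.pi)

instance torusFact : Fact (0 < 2 * Real.pi) := ⟨Real.two_pi_pos⟩

/-- The Riemannian (uniform) probability measure `λ` on the circle. -/
abbrev unif : Measure Torus := AddCircle.haarAddCircle

/-- `ν` has a density with respect to `λ` which satisfies
`|ν(y) - ν(x)| ≤ A d(x,y)^a` for all `x, y`. -/
def HasHolderDensity (ν : Measure Torus) (a A : ℝ) : Prop :=
  ∃ n : Torus → ℝ, (∀ x, 0 ≤ n x) ∧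
    (∀ x y, |n y - n x| ≤ A * dist x y ^ a) ∧
    ν = unif.withDensity (fun x => ENNReal.ofReal (n x))

/-- The potential `U_p(x) = ∫ d(x,y)^p ν(dy)`. -/
def potential (p : ℝ) (ν : Measure Torus) (x : Torus) : ℝ :=
  ∫ y, dist x y ^ p ∂ν

/-- The Gibbs measure `μ_β(dx) = exp(-β U_p(x)) λ(dx) / Z_β`. -/
def gibbs (p β : ℝ) (ν : Measure Torus) : Measure Torus :=
  unif.tilted (fun x => -β * potential p ν x)

/-- The representative in `(-π, π]` of a point of the circle. -/
def rep (z : Torus) : ℝ := (AddCircle.equivIoc (2 * Real.pi) (-Real.pi) z : ℝ)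

/-- The minimal geodesic with unit speed which starts at `x` and leads to `y`, at time `t`.
If `y = x + π`, the anti-clockwise one is taken. If `y = x`, it is constant. -/
def geod (x y : Torus) (t : ℝ) : Torus :=
  x + (((SignType.sign (rep (y - x)) : ℝ) * t : ℝ) : Torus)

/-- The second derivative `∂²f` of a function on the circle. -/
def secondDeriv (f : Torus → ℝ) (x : Torus) : ℝ :=
  iteratedDeriv 2 (fun t : ℝ => f (x + (t : Torus))) 0

/-- The exponent `a(p)`. -/
def expo (a p : ℝ) : ℝ := if 1 < p ∧ p < 2 then min a (p - 1) else a

/-- The generator of the algorithm as an operator on functions: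
`L f(x) = ∂²f(x)/2 + (1/α) ∫ (f(γ(x, y, (p/2) β α d(x,y)^(p-1))) - f(x)) ν(dy)`. -/
def genFun (p α β : ℝ) (ν : Measure Torus) (f : Torus → ℝ) (x : Torus) : ℝ :=
  1 / 2 * secondDeriv f x +
    1 / α * ∫ y, (f (geod x y (p / 2 * β * α * dist x y ^ (p - 1))) - f x) ∂ν

/-- The algebra of functions of class `C²` on the circle. -/
def C2 : Subalgebra ℝ C(Torus, ℝ) where
  carrier := {f | ContDiff ℝ 2 (fun t : ℝ => f (t : Torus))}
  mul_mem' {f g} hf hg := by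
    simpa using ContDiff.mul (mem_ofPred.mp hf) (mem_ofPred.mp hg)
  add_mem' {f g} hf hg := by
    simpa using ContDiff.add (mem_ofPred.mp hf) (mem_ofPred.mp hg)
  algebraMap_mem' r := by
    simpa using (contDiff_const : ContDiff ℝ 2 (fun _ : ℝ => r))

theorem contDiff_shift (f : C2) (x : Torus) :
    ContDiff ℝ 2 (fun t : ℝ => (f : C(Torus, ℝ)) (x + (t : Torus))) := by
  induction x using QuotientAddGroup.induction_on with
  | H u =>
    have h : ContDiff ℝ 2 (fun t : ℝ => (f : C(Torus, ℝ)) (t : Torus)) := f.2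
    have := h.comp (contDiff_const (c := u) |>.add contDiff_id)
    simpa [Function.comp_def] using this

theorem secondDeriv_coe (f : Torus → ℝ) (u : ℝ) :
    secondDeriv f (u : Torus) = iteratedDeriv 2 (fun t : ℝ => f (t : Torus)) u := by
  have := iteratedDeriv_comp_const_add 2 (fun t : ℝ => f (t : Torus)) u
  have h2 := congrFun this 0
  simpa [secondDeriv] using h2

theorem continuous_secondDeriv (f : C2) : Continuous (secondDeriv (f : C(Torus, ℝ))) := by
  have h : ContDiff ℝ 2 (fun t : ℝ => (f : C(Torus, ℝ)) (t : Torus)) := f.2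
  have h2 := h.continuous_iteratedDeriv 2 le_rfl
  refine (QuotientAddGroup.isQuotientMap_mk (N := AddSubgroup.zmultiples (2 * Real.pi))
    ).continuous_iff.2 ?_
  refine h2.congr fun u => ?_
  exact (secondDeriv_coe _ u).symm

theorem measurable_rep : Measurable rep :=
  measurable_subtype_coe.comp (AddCircle.measurableEquivIoc (2 * Real.pi) (-Real.pi)).measurable

theorem measurable_geod {α : Type*} [MeasurableSpace α] {x y : α → Torus} {t : α → ℝ}
    (hx : Measurable x) (hy : Measurable y) (ht : Measurable t) :
    Measurable (fun w => geod (x w) (y w) (t w)) := by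
  have hs : Measurable (fun r : ℝ => ((SignType.sign r : SignType) : ℝ)) := by
    have h : (fun r : ℝ => ((SignType.sign r : SignType) : ℝ)) =
        fun r => if 0 < r then 1 else if r < 0 then -1 else 0 := by
      ext r
      rw [sign_apply]
      split_ifs <;> simp
    rw [h]
    exact Measurable.ite measurableSet_Ioi measurable_const
      (Measurable.ite measurableSet_Iio measurable_const measurable_const)
  refine hx.add (AddCircle.measurable_mk'.comp ?_)
  exact (hs.comp (measurable_rep.comp (hy.sub hx))).mul ht

theorem measurable_jump (p c : ℝ) (f : C(Torus, ℝ)) :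
    Measurable (fun w : Torus × Torus =>
      f (geod w.1 w.2 (c * dist w.1 w.2 ^ (p - 1))) - f w.1) := by
  refine (f.continuous.measurable.comp (measurable_geod measurable_fst measurable_snd
    (measurable_const.mul ?_))).sub (f.continuous.measurable.comp measurable_fst)
  exact (measurable_fst.dist measurable_snd).pow_const _

theorem norm_jump_le (f : C(Torus, ℝ)) (x y : Torus) : ‖f x - f y‖ ≤ 2 * ‖f‖ := by
  calc _ ≤ ‖f x‖ + ‖f y‖ := norm_sub_le _ _
    _ ≤ ‖f‖ + ‖f‖ := add_le_add (f.norm_coe_le_norm x) (f.norm_coe_le_norm y)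
    _ = _ := by ring

theorem genFun_smul (p α β : ℝ) (ν : Measure Torus) (c : ℝ) (f : C2) (x : Torus) :
    genFun p α β ν ((c • f : C2) : C(Torus, ℝ)) x = c * genFun p α β ν (f : C(Torus, ℝ)) x := by
  have h1 : secondDeriv ((c • f : C2) : C(Torus, ℝ)) x = c * secondDeriv (f : C(Torus, ℝ)) x := by
    simp only [secondDeriv]
    exact iteratedDeriv_const_mul (n := 2) (x := 0) c (contDiff_shift f x).contDiffAt
  simp only [genFun]
  rw [h1]
  have h3 : ∫ y, (((c • f : C2) : C(Torus, ℝ)) (geod x y (p / 2 * β * α * dist x y ^ (p - 1)))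
      - ((c • f : C2) : C(Torus, ℝ)) x) ∂ν = c * ∫ y, ((f : C(Torus, ℝ))
        (geod x y (p / 2 * β * α * dist x y ^ (p - 1))) - (f : C(Torus, ℝ)) x) ∂ν := by
    rw [← integral_const_mul]
    refine integral_congr_ae (Filter.Eventually.of_forall fun y => ?_)
    simp only [Subalgebra.coe_smul, ContinuousMap.smul_apply, smul_eq_mul]
    ring
  rw [h3]
  ring

section measures

variable (p α β : ℝ) (ν : Measure Torus) [IsProbabilityMeasure ν]

theorem integrable_jump (c : ℝ) (f : C(Torus, ℝ)) (x : Torus) :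
    Integrable (fun y => f (geod x y (c * dist x y ^ (p - 1))) - f x) ν :=
  Integrable.of_bound
    ((measurable_jump p c f).comp measurable_prodMk_left).aestronglyMeasurable (2 * ‖f‖)
    (Filter.Eventually.of_forall fun _ => norm_jump_le f _ _)

theorem measurable_genFun (f : C2) : Measurable (genFun p α β ν (f : C(Torus, ℝ))) := by
  refine ((continuous_secondDeriv f).measurable.const_mul _).add (Measurable.const_mul ?_ _)
  exact ((measurable_jump p (p / 2 * β * α) f).stronglyMeasurable.integral_prod_right').measurable

theorem exists_genFun_bound (f : C2) : ∃ K, ∀ x, ‖genFun p α β ν (f : C(Torus, ℝ)) x‖ ≤ K := by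
  let g : C(Torus, ℝ) := ⟨_, continuous_secondDeriv f⟩
  refine ⟨‖(1 / 2 : ℝ)‖ * ‖g‖ + ‖1 / α‖ * (2 * ‖(f : C(Torus, ℝ))‖), fun x => ?_⟩
  refine (norm_add_le _ _).trans (add_le_add ?_ ?_)
  · rw [norm_mul]
    exact mul_le_mul_of_nonneg_left (g.norm_coe_le_norm x) (norm_nonneg _)
  · rw [norm_mul]
    refine mul_le_mul_of_nonneg_left ?_ (norm_nonneg _)
    have := norm_integral_le_of_norm_le_const (μ := ν) (C := 2 * ‖(f : C(Torus, ℝ))‖)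
      (f := fun y => (f : C(Torus, ℝ)) (geod x y (p / 2 * β * α * dist x y ^ (p - 1)))
        - (f : C(Torus, ℝ)) x)
      (Filter.Eventually.of_forall fun _ => norm_jump_le _ _ _)
    simpa using this

theorem memLp_genFun (μ : Measure Torus) [IsFiniteMeasure μ] (f : C2) :
    MemLp (genFun p α β ν (f : C(Torus, ℝ))) 2 μ := by
  obtain ⟨K, hK⟩ := exists_genFun_bound p α β ν f
  exact MemLp.of_bound (measurable_genFun p α β ν f).aestronglyMeasurable K
    (Filter.Eventually.of_forall hK)

theorem genFun_add (f g : C2) (x : Torus) :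
    genFun p α β ν ((f + g : C2) : C(Torus, ℝ)) x =
      genFun p α β ν (f : C(Torus, ℝ)) x + genFun p α β ν (g : C(Torus, ℝ)) x := by
  have h1 : secondDeriv ((f + g : C2) : C(Torus, ℝ)) x =
      secondDeriv (f : C(Torus, ℝ)) x + secondDeriv (g : C(Torus, ℝ)) x := by
    simp only [secondDeriv]
    rw [← iteratedDeriv_add (contDiff_shift f x).contDiffAt (contDiff_shift g x).contDiffAt]
    rfl
  simp only [genFun]
  rw [h1]
  have h2 := integral_add (integrable_jump p ν (p / 2 * β * α) (f : C(Torus, ℝ)) x)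
    (integrable_jump p ν (p / 2 * β * α) (g : C(Torus, ℝ)) x)
  have h3 : ∫ y, (((f + g : C2) : C(Torus, ℝ)) (geod x y (p / 2 * β * α * dist x y ^ (p - 1)))
      - ((f + g : C2) : C(Torus, ℝ)) x) ∂ν =
      ∫ y, ((f : C(Torus, ℝ)) (geod x y (p / 2 * β * α * dist x y ^ (p - 1)))
        - (f : C(Torus, ℝ)) x) ∂ν +
      ∫ y, ((g : C(Torus, ℝ)) (geod x y (p / 2 * β * α * dist x y ^ (p - 1)))
        - (g : C(Torus, ℝ)) x) ∂ν := by
    rw [← h2]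
    refine integral_congr_ae (Filter.Eventually.of_forall fun y => ?_)
    simp only [Subalgebra.coe_add, ContinuousMap.add_apply]
    ring
  rw [h3]
  ring

theorem integrable_exp_potential {β : ℝ} (hβ : 0 ≤ β) :
    Integrable (fun x => Real.exp (-β * potential p ν x)) unif := by
  have hm : Measurable (potential p ν) := by
    have : Measurable (fun w : Torus × Torus => dist w.1 w.2 ^ p) :=
      (measurable_fst.dist measurable_snd).pow_const _
    exact this.stronglyMeasurable.integral_prod_right'.measurable
  refine Integrable.of_bound (hm.const_mul _).exp.aestronglyMeasurable 1
    (Filter.Eventually.of_forall fun x => ?_)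
  rw [Real.norm_eq_abs, Real.abs_exp, Real.exp_le_one_iff]
  have : 0 ≤ potential p ν x := integral_nonneg fun y => Real.rpow_nonneg dist_nonneg _
  nlinarith

instance isFiniteMeasure_gibbs : IsFiniteMeasure (gibbs p β ν) := by
  by_cases h : Integrable (fun x => Real.exp (-β * potential p ν x)) unif
  · have := isProbabilityMeasure_tilted h
    exact inferInstanceAs (IsFiniteMeasure (unif.tilted _))
  · rw [gibbs, tilted_of_not_integrable h]
    infer_instance

theorem isProbabilityMeasure_gibbs {β : ℝ} (hβ : 0 ≤ β) :
    IsProbabilityMeasure (gibbs p β ν) :=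
  isProbabilityMeasure_tilted (integrable_exp_potential p ν hβ)

/-- The class in `L²(μ_β)` of a function of class `C²`. -/
def toL2 : C2 →ₗ[ℝ] Lp ℝ 2 (gibbs p β ν) :=
  (ContinuousMap.toLp (E := ℝ) 2 (gibbs p β ν) ℝ).toLinearMap ∘ₗ C2.val.toLinearMap

theorem toL2_injective {β : ℝ} (hβ : 0 ≤ β) : Function.Injective (toL2 p β ν) := by
  have : (gibbs p β ν).IsOpenPosMeasure :=
    (absolutelyContinuous_tilted (integrable_exp_potential p ν hβ)).isOpenPosMeasure
  exact (ContinuousMap.toLp_injective (𝕜 := ℝ) (p := 2) (gibbs p β ν)).comp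
    Subtype.val_injective

/-- The class in `L²(μ_β)` of `L f`, for `f` of class `C²`. -/
def genL2 : C2 →ₗ[ℝ] Lp ℝ 2 (gibbs p β ν) where
  toFun f := (memLp_genFun p α β ν (gibbs p β ν) f).toLp _
  map_add' f g := by
    rw [← MemLp.toLp_add]
    exact MemLp.toLp_congr _ _ (Filter.Eventually.of_forall fun x => genFun_add p α β ν f g x)
  map_smul' c f := by
    rw [RingHom.id_apply, ← MemLp.toLp_const_smul]
    exact MemLp.toLp_congr _ _ (Filter.Eventually.of_forall fun x => genFun_smul p α β ν c f x)

/-- The generator `L_{α,β}` as an unbounded operator on `L²(μ_β)`, with domain `C²(𝕋)`. -/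
def generator {β : ℝ} (hβ : 0 ≤ β) : Lp ℝ 2 (gibbs p β ν) →ₗ.[ℝ] Lp ℝ 2 (gibbs p β ν) where
  domain := LinearMap.range (toL2 p β ν)
  toFun := genL2 p α β ν ∘ₗ
    (LinearEquiv.ofInjective (toL2 p β ν) (toL2_injective p ν hβ)).symm.toLinearMap

/-- The operator sends the class of `f` to the class of `L f`. -/
theorem generator_apply {β : ℝ} (hβ : 0 ≤ β) (f : C2) :
    generator p α ν hβ ⟨toL2 p β ν f, LinearMap.mem_range_self _ f⟩ = genL2 p α β ν f := by
  change genL2 p α β ν ((LinearEquiv.ofInjective (toL2 p β ν) (toL2_injective p ν hβ)).symm _) = _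
  congr 1
  exact (LinearEquiv.ofInjective (toL2 p β ν) (toL2_injective p ν hβ)).symm_apply_apply f

/-- The constant function `1` in `L²(μ_β)`. -/
def oneL2 : Lp ℝ 2 (gibbs p β ν) := toL2 p β ν 1

theorem dense_C2 : Dense (C2 : Set C(Torus, ℝ)) := by
  have hsep : C2.SeparatesPoints := by
    have hc : ContDiff ℝ 2 (fun t : ℝ => Real.cos t) := Real.contDiff_cos
    have hs : ContDiff ℝ 2 (fun t : ℝ => Real.sin t) := Real.contDiff_sin
    intro x y hxy
    by_contra hne
    push Not at hne
    refine hxy ?_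
    let c : C(Torus, ℝ) := ⟨Real.cos_periodic.lift, continuous_coinduced_dom.2 Real.continuous_cos⟩
    let s : C(Torus, ℝ) := ⟨Real.sin_periodic.lift, continuous_coinduced_dom.2 Real.continuous_sin⟩
    have h1 := hne c ⟨c, hc, rfl⟩
    have h2 := hne s ⟨s, hs, rfl⟩
    induction x using QuotientAddGroup.induction_on with
    | H u =>
      induction y using QuotientAddGroup.induction_on with
      | H v =>
        exact Real.Angle.cos_sin_inj h1 h2
  have := ContinuousMap.subalgebra_topologicalClosure_eq_top_of_separatesPoints C2 hsep
  rw [dense_iff_closure_eq, ← Subalgebra.topologicalClosure_coe, this]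
  rfl

/-- The generator is densely defined, so that its adjoint is meaningful. -/
theorem dense_generator_domain {β : ℝ} (hβ : 0 ≤ β) :
    Dense ((generator p α ν hβ).domain : Set (Lp ℝ 2 (gibbs p β ν))) := by
  have h1 := (ContinuousMap.toLp_denseRange ℝ (gibbs p β ν) ℝ (p := 2) (by simp))
  have h2 := h1.dense_image (ContinuousMap.toLp (E := ℝ) 2 (gibbs p β ν) ℝ).continuous dense_C2
  refine h2.mono ?_
  rintro _ ⟨f, hf, rfl⟩
  exact ⟨⟨f, hf⟩, rfl⟩

end measures

end

end CircleMeans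

/-! Let `E = exp (-β U)`. Up to normalization `E` is the density of `μ_β`, so `L* 1` is `1 / E`
times the dual of `L` for the uniform measure applied to `E`. In terms of the displacement `w = y -
x`, a jump is a translation by `jumpShift p c w`, with `c = p β α / 2`, which does not depend on
`x`. Fubini and the invariance of Haar measure therefore give the dual of the jump part (`jumpDual`,
`integral_mul_jump_eq`), with no inverse map or Jacobian. The diffusion part is symmetric
(`integral_mul_secondDeriv_comm`).

It remains to expand `jumpDual` to first order in `c`. On the half circle `w = θ`, `0 < θ < π`, the
jump is `c θ ^ q` with `q = p - 1`; the other half is its mirror image. Since the density `N` is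
only Hölder continuous and `q θ ^ (q - 1)` may be singular at `0`, `N` is never differentiated: `N
(z + θ - c θ ^ q)` is integrated by way of a primitive of `N`. Each error is then an oscillation of
`N` at the scale `S = c π ^ q` times `S`, which is of order `S ^ (1 + a)`
(`abs_integral_displaced_sub_le`). The ratio `E (z - s) / E z` is expanded by Taylor's formula, as
`U` is of class `C²` (`abs_integral_weighted_displaced_sub_le`).

The first order terms are multiples of the integrals that give `U'` and `U''`. The factor `p / 2` in
the jump is the one for which they sum to `(β U'' - β² U' ^ 2) / 2`, which cancels `E'' / (2 E)`
exactly (`abs_adjoint_numerator_le`). After division by `α` the errors are at most a constant times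
`α ^ a β ^ 4` uniformly on the circle, and the `L²` norm for a probability measure is at most this
bound. This holds with exponent `a` for every `p`; as `α ≤ 1` and `a(p) ≤ a`, it implies the claim.
-/

namespace CircleMeans

noncomputable section

/-! ### Averages of a function on the line against a power -/

/-- The integral of `θ ^ q * N (z + θ)` over `0 < θ < π`. -/
def powAvg (q : ℝ) (N : ℝ → ℝ) (z : ℝ) : ℝ := ∫ θ in 0..Real.pi, θ ^ q * N (z + θ)

/-- The derivative of `powAvg q N`. -/
def powAvgDeriv (q : ℝ) (N : ℝ → ℝ) (z : ℝ) : ℝ :=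
  Real.pi ^ q * N (z + Real.pi) - 0 ^ q * N z - ∫ θ in 0..Real.pi, q * θ ^ (q - 1) * N (z + θ)

/-- The prefactor `q` stays attached to the weight because at `q = 0`, the case `p = 1`, it
annihilates `θ ^ (-1)`, which is not integrable. For `0 < q < 1` the singularity is integrable. -/
theorem intervalIntegrable_mul_rpow_sub_one {q : ℝ} (hq : 0 ≤ q) :
    IntervalIntegrable (fun θ : ℝ => q * θ ^ (q - 1)) volume 0 Real.pi := by
  rcases hq.eq_or_lt with rfl | hq
  · simp
  · exact (intervalIntegral.intervalIntegrable_rpow' (by linarith)).const_mul _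

theorem hasDerivAt_rpow_of_pos (q : ℝ) {θ : ℝ} (hθ : 0 < θ) :
    HasDerivAt (fun x : ℝ => x ^ q) (q * θ ^ (q - 1)) θ :=
  Real.hasDerivAt_rpow_const (Or.inl hθ.ne')

theorem continuous_rpow_of_nonneg {q : ℝ} (hq : 0 ≤ q) : Continuous fun x : ℝ => x ^ q :=
  Real.continuous_rpow_const hq

/-- At `q = 0` both sides vanish, by the convention `0 ^ 0 = 1`. The mass is at most `π ^ q`, so the
singular weight for `1 < p < 2` costs no factor `1 / q`. -/
theorem integral_mul_rpow_sub_one {q : ℝ} (hq : 0 ≤ q) :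
    ∫ θ in 0..Real.pi, q * θ ^ (q - 1) = Real.pi ^ q - 0 ^ q :=
  intervalIntegral.integral_eq_sub_of_hasDerivAt_of_le Real.pi_pos.le
    (continuous_rpow_of_nonneg hq).continuousOn
    (fun _ hx => hasDerivAt_rpow_of_pos q hx.1) (intervalIntegrable_mul_rpow_sub_one hq)

theorem rpow_le_pi_rpow {q θ : ℝ} (hq : 0 ≤ q) (h0 : 0 ≤ θ) (h1 : θ ≤ Real.pi) :
    θ ^ q ≤ Real.pi ^ q := Real.rpow_le_rpow h0 h1 hq

theorem zero_rpow_nonneg (q : ℝ) : (0 : ℝ) ≤ 0 ^ q := Real.rpow_nonneg le_rfl q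

theorem intervalIntegrable_mul_rpow_mul {q : ℝ} (hq : 0 ≤ q) {f : ℝ → ℝ} (hf : Continuous f) :
    IntervalIntegrable (fun θ : ℝ => q * θ ^ (q - 1) * f θ) volume 0 Real.pi :=
  (intervalIntegrable_mul_rpow_sub_one hq).mul_continuousOn hf.continuousOn

/-- A bounded continuous function integrates against `q θ ^ (q - 1)` to at most
`π ^ q` times the bound. -/
theorem abs_integral_mul_rpow_mul_le {q K : ℝ} (hq : 0 ≤ q) {f : ℝ → ℝ}
    (hK : ∀ θ, 0 < θ → θ ≤ Real.pi → |f θ| ≤ K) :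
    |∫ θ in 0..Real.pi, q * θ ^ (q - 1) * f θ| ≤ Real.pi ^ q * K := by
  have hK0 : 0 ≤ K := (abs_nonneg _).trans (hK _ Real.pi_pos le_rfl)
  have h := intervalIntegral.norm_integral_le_of_norm_le (μ := volume) (a := 0) (b := Real.pi)
    (f := fun θ => q * θ ^ (q - 1) * f θ) (g := fun θ => q * θ ^ (q - 1) * K) Real.pi_pos.le
    (Filter.Eventually.of_forall fun θ hθ => by
      rw [norm_mul, Real.norm_of_nonneg (mul_nonneg hq (Real.rpow_nonneg hθ.1.le _))]
      exact mul_le_mul_of_nonneg_left (hK θ hθ.1 hθ.2)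
        (mul_nonneg hq (Real.rpow_nonneg hθ.1.le _)))
    ((intervalIntegrable_mul_rpow_sub_one hq).mul_const K)
  rw [intervalIntegral.integral_mul_const, integral_mul_rpow_sub_one hq] at h
  refine h.trans (mul_le_mul_of_nonneg_right ?_ hK0)
  linarith [zero_rpow_nonneg q]

theorem abs_integral_le_pi_mul {K : ℝ} {f : ℝ → ℝ}
    (hK : ∀ θ, 0 ≤ θ → θ ≤ Real.pi → |f θ| ≤ K) :
    |∫ θ in 0..Real.pi, f θ| ≤ Real.pi * K := by
  have := intervalIntegral.norm_integral_le_of_norm_le_const (a := 0) (b := Real.pi) (f := f)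
    (C := K) (fun θ hθ => by
      rw [uIoc_of_le Real.pi_pos.le] at hθ
      exact hK θ hθ.1.le hθ.2)
  rw [sub_zero, abs_of_pos Real.pi_pos, mul_comm] at this
  exact this

theorem hasDerivAt_primitive {N : ℝ → ℝ} (hN : Continuous N) (z : ℝ) :
    HasDerivAt (fun x => ∫ t in 0..x, N t) (N z) z :=
  intervalIntegral.integral_hasDerivAt_right (hN.intervalIntegrable _ _)
    hN.stronglyMeasurable.stronglyMeasurableAtFilter hN.continuousAt

theorem continuous_primitive {N : ℝ → ℝ} (hN : Continuous N) :
    Continuous fun x => ∫ t in 0..x, N t :=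
  continuous_iff_continuousAt.2 fun z => (hasDerivAt_primitive hN z).continuousAt

/-- Integration by parts replaces `N` by a primitive, so that the right side can be differentiated
in `z` even when `N` cannot. -/
theorem powAvg_eq_primitive {q : ℝ} (hq : 0 ≤ q) {N : ℝ → ℝ} (hN : Continuous N) (z : ℝ) :
    powAvg q N z = Real.pi ^ q * (∫ t in 0..(z + Real.pi), N t) - 0 ^ q * (∫ t in 0..z, N t) -
      ∫ θ in 0..Real.pi, q * θ ^ (q - 1) * ∫ t in 0..(z + θ), N t := by
  have h := intervalIntegral.integral_mul_deriv_eq_deriv_mul_of_hasDerivAt (a := 0) (b := Real.pi)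
    (u := fun θ : ℝ => θ ^ q) (v := fun θ => ∫ t in 0..(z + θ), N t)
    (u' := fun θ => q * θ ^ (q - 1)) (v' := fun θ => N (z + θ))
    (continuous_rpow_of_nonneg hq).continuousOn
    ((continuous_primitive hN).comp (continuous_const.add continuous_id)).continuousOn
    (fun x hx => hasDerivAt_rpow_of_pos q (by
      rw [min_eq_left Real.pi_pos.le] at hx
      exact hx.1))
    (fun x _ => (hasDerivAt_primitive hN (z + x)).comp_const_add z x)
    (intervalIntegrable_mul_rpow_sub_one hq)
    ((hN.comp (continuous_const.add continuous_id)).intervalIntegrable _ _)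
  simpa only [powAvg, add_zero] using h

theorem hasDerivAt_powAvg {q M : ℝ} (hq : 0 ≤ q) {N : ℝ → ℝ} (hN : Continuous N)
    (hM : ∀ t, |N t| ≤ M) (z : ℝ) : HasDerivAt (powAvg q N) (powAvgDeriv q N z) z := by
  have hfun : powAvg q N = fun z =>
      Real.pi ^ q * (∫ t in 0..(z + Real.pi), N t) - 0 ^ q * (∫ t in 0..z, N t) -
      ∫ θ in 0..Real.pi, q * θ ^ (q - 1) * ∫ t in 0..(z + θ), N t :=
    funext (powAvg_eq_primitive hq hN)
  rw [hfun]
  -- The boundary terms are differentiated directly, the last integral under the integral sign; its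
  -- dominating function is the integrable weight times `M`.
  refine ((((hasDerivAt_primitive hN (z + Real.pi)).comp_add_const z Real.pi).const_mul _).sub
    ((hasDerivAt_primitive hN z).const_mul _)).sub ?_
  have hG := continuous_primitive hN
  refine (intervalIntegral.hasDerivAt_integral_of_dominated_loc_of_deriv_le (𝕜 := ℝ)
    (F := fun z θ => q * θ ^ (q - 1) * ∫ t in 0..(z + θ), N t)
    (F' := fun z θ => q * θ ^ (q - 1) * N (z + θ)) (s := univ)
    (bound := fun θ => q * θ ^ (q - 1) * M) Filter.univ_mem
    (Filter.Eventually.of_forall fun x => ?_) ?_ ?_ ?_ ?_ ?_).2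
  · exact (intervalIntegrable_mul_rpow_mul hq
      (hG.comp (continuous_const.add continuous_id))).def'.aestronglyMeasurable
  · exact intervalIntegrable_mul_rpow_mul hq (hG.comp (continuous_const.add continuous_id))
  · exact (intervalIntegrable_mul_rpow_mul hq
      (hN.comp (continuous_const.add continuous_id))).def'.aestronglyMeasurable
  · refine Filter.Eventually.of_forall fun θ hθ x _ => ?_
    rw [uIoc_of_le Real.pi_pos.le] at hθ
    have h0 := mul_nonneg hq (Real.rpow_nonneg hθ.1.le (q - 1))
    rw [norm_mul, Real.norm_of_nonneg h0]
    exact mul_le_mul_of_nonneg_left (hM _) h0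
  · exact (intervalIntegrable_mul_rpow_sub_one hq).mul_const M
  · exact Filter.Eventually.of_forall fun θ _ x _ =>
      ((hasDerivAt_primitive hN (x + θ)).comp_add_const x θ).const_mul _

theorem continuous_powAvgDeriv {q M : ℝ} (hq : 0 ≤ q) {N : ℝ → ℝ} (hN : Continuous N)
    (hM : ∀ t, |N t| ≤ M) : Continuous (powAvgDeriv q N) := by
  unfold powAvgDeriv
  refine ((continuous_const.mul (by fun_prop)).sub (continuous_const.mul hN)).sub ?_
  refine intervalIntegral.continuous_of_dominated_interval
    (bound := fun θ => q * θ ^ (q - 1) * M) (fun x => ?_) (fun x => ?_)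
    ((intervalIntegrable_mul_rpow_sub_one hq).mul_const M) ?_
  · exact (intervalIntegrable_mul_rpow_mul hq
      (hN.comp (continuous_const.add continuous_id))).def'.aestronglyMeasurable
  · refine Filter.Eventually.of_forall fun θ hθ => ?_
    rw [uIoc_of_le Real.pi_pos.le] at hθ
    have h0 := mul_nonneg hq (Real.rpow_nonneg hθ.1.le (q - 1))
    rw [norm_mul, Real.norm_of_nonneg h0]
    exact mul_le_mul_of_nonneg_left (hM _) h0
  · exact Filter.Eventually.of_forall fun θ _ => by fun_prop

theorem abs_powAvg_le {q M : ℝ} (hq : 0 ≤ q) {N : ℝ → ℝ} (hM : ∀ t, |N t| ≤ M) (z : ℝ) :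
    |powAvg q N z| ≤ Real.pi * (Real.pi ^ q * M) := by
  refine abs_integral_le_pi_mul fun θ h0 h1 => ?_
  rw [abs_mul, abs_of_nonneg (Real.rpow_nonneg h0 _)]
  exact mul_le_mul (rpow_le_pi_rpow hq h0 h1) (hM _) (abs_nonneg _)
    (Real.rpow_nonneg Real.pi_pos.le _)

theorem abs_powAvgDeriv_le {q M : ℝ} (hq : 0 ≤ q) {N : ℝ → ℝ} (hM : ∀ t, |N t| ≤ M) (z : ℝ) :
    |powAvgDeriv q N z| ≤ 3 * (Real.pi ^ q * M) := by
  have hp : 0 ≤ Real.pi ^ q := Real.rpow_nonneg Real.pi_pos.le _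
  have hM0 : 0 ≤ M := (abs_nonneg _).trans (hM 0)
  have h1 : |Real.pi ^ q * N (z + Real.pi)| ≤ Real.pi ^ q * M := by
    rw [abs_mul, abs_of_nonneg hp]
    exact mul_le_mul_of_nonneg_left (hM _) hp
  have h2 : |0 ^ q * N z| ≤ Real.pi ^ q * M := by
    rw [abs_mul, abs_of_nonneg (zero_rpow_nonneg q)]
    exact mul_le_mul (rpow_le_pi_rpow hq le_rfl Real.pi_pos.le) (hM _) (abs_nonneg _) hp
  have h3 := abs_integral_mul_rpow_mul_le hq (f := fun θ => N (z + θ)) (fun θ _ _ => hM _)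
  unfold powAvgDeriv
  calc _ ≤ |Real.pi ^ q * N (z + Real.pi)| + |0 ^ q * N z| + _ :=
        (abs_sub _ _).trans (add_le_add_left (abs_sub _ _) _)
    _ ≤ _ := by linarith

/-! ### Displacement of a Hölder function -/

theorem continuous_of_holder {N : ℝ → ℝ} {A a : ℝ} (ha : 0 < a)
    (hN : ∀ x y, |N y - N x| ≤ A * |y - x| ^ a) : Continuous N := by
  refine continuous_iff_continuousAt.2 fun x => ?_
  refine tendsto_iff_norm_sub_tendsto_zero.2 ?_
  have h : Filter.Tendsto (fun y => A * |y - x| ^ a) (nhds x) (nhds (A * |x - x| ^ a)) := by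
    have : Continuous fun y : ℝ => A * |y - x| ^ a :=
      continuous_const.mul ((Real.continuous_rpow_const ha.le).comp (by fun_prop))
    exact this.tendsto x
  rw [sub_self, abs_zero, Real.zero_rpow ha.ne', mul_zero] at h
  exact squeeze_zero (fun _ => norm_nonneg _) (fun y => hN x y) h

/-- The effect on an integral of displacing the argument by `c * θ ^ q`. -/
theorem abs_integral_displaced_sub_le {N : ℝ → ℝ} {A a q c : ℝ} (ha : 0 < a) (hA : 0 ≤ A)
    (hq : 0 ≤ q) (hc : 0 ≤ c) (hN : ∀ x y, |N y - N x| ≤ A * |y - x| ^ a) (z : ℝ) :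
    |(∫ θ in 0..Real.pi, (N (z + θ - c * θ ^ q) - N (z + θ))) + c * powAvgDeriv q N z| ≤
      3 * A * (c * Real.pi ^ q) ^ a * (c * Real.pi ^ q) := by
  have hNc := continuous_of_holder ha hN
  set S := c * Real.pi ^ q with hS
  have hS0 : 0 ≤ S := mul_nonneg hc (Real.rpow_nonneg Real.pi_pos.le _)
  have hφc : Continuous fun θ : ℝ => z + θ - c * θ ^ q :=
    (continuous_const.add continuous_id).sub
      (continuous_const.mul (continuous_rpow_of_nonneg hq))
  have hφ : ∀ θ, 0 ≤ θ → θ ≤ Real.pi → 0 ≤ c * θ ^ q ∧ c * θ ^ q ≤ S := fun θ h0 h1 =>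
    ⟨mul_nonneg hc (Real.rpow_nonneg h0 _),
      mul_le_mul_of_nonneg_left (rpow_le_pi_rpow hq h0 h1) hc⟩
  have hosc : ∀ x y, |y - x| ≤ S → |N y - N x| ≤ A * S ^ a := fun x y h =>
    (hN x y).trans (mul_le_mul_of_nonneg_left (Real.rpow_le_rpow (abs_nonneg _) h ha.le) hA)
  -- the primitive at a displaced point
  have hprim : ∀ x s, 0 ≤ s → s ≤ S →
      |(∫ t in 0..(x - s), N t) - (∫ t in 0..x, N t) + s * N x| ≤ A * S ^ a * S := by
    intro x s h0 h1
    have e : (∫ t in 0..(x - s), N t) - (∫ t in 0..x, N t) + s * N x =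
        ∫ t in x..(x - s), (N t - N x) := by
      rw [intervalIntegral.integral_sub (hNc.intervalIntegrable _ _)
        (by simp), ← intervalIntegral.integral_interval_sub_left
        (hNc.intervalIntegrable 0 (x - s)) (hNc.intervalIntegrable 0 x)]
      simp
    rw [e]
    have h := intervalIntegral.norm_integral_le_of_norm_le_const (a := x) (b := x - s)
      (f := fun t => N t - N x) (C := A * S ^ a) (fun t ht => by
        rw [uIoc_of_ge (by linarith)] at ht
        exact hosc x t (abs_le.2 ⟨by linarith [ht.1], by linarith [ht.2]⟩))
    refine h.trans (mul_le_mul_of_nonneg_left ?_ (mul_nonneg hA (Real.rpow_nonneg hS0 _)))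
    rw [show x - s - x = -s by ring, abs_neg, abs_of_nonneg h0]
    exact h1
  have hint1 : IntervalIntegrable (fun θ => q * θ ^ (q - 1) * N (z + θ - c * θ ^ q))
      volume 0 Real.pi := intervalIntegrable_mul_rpow_mul hq (hNc.comp hφc)
  have hint2 : IntervalIntegrable (fun θ => q * θ ^ (q - 1) * N (z + θ)) volume 0 Real.pi :=
    intervalIntegrable_mul_rpow_mul hq (hNc.comp (continuous_const.add continuous_id))
  have hint3 : IntervalIntegrable (fun θ => N (z + θ - c * θ ^ q)) volume 0 Real.pi :=
    (hNc.comp hφc).intervalIntegrable _ _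
  have hint4 : IntervalIntegrable (fun θ => N (z + θ)) volume 0 Real.pi :=
    (hNc.comp (continuous_const.add continuous_id)).intervalIntegrable _ _
  -- The integrand is the derivative of a primitive of `N` at `z + θ - c * θ ^ q`. The lower
  -- endpoint keeps `c * 0 ^ q`: it is `c` when `q = 0`, where even a short geodesic is followed for
  -- the full time `c`.
  have hftc : (∫ θ in 0..Real.pi, (N (z + θ - c * θ ^ q) -
        c * (q * θ ^ (q - 1) * N (z + θ - c * θ ^ q)))) =
      (∫ t in 0..(z + Real.pi - S), N t) - ∫ t in 0..(z - c * 0 ^ q), N t := by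
    have h := intervalIntegral.integral_eq_sub_of_hasDerivAt_of_le (a := 0) (b := Real.pi)
      (f := fun θ => ∫ t in 0..(z + θ - c * θ ^ q), N t)
      (f' := fun θ => N (z + θ - c * θ ^ q) -
        c * (q * θ ^ (q - 1) * N (z + θ - c * θ ^ q))) Real.pi_pos.le
      ((continuous_primitive hNc).comp hφc).continuousOn
      (fun θ hθ => by
        have h1 := (hasDerivAt_primitive hNc (z + θ - c * θ ^ q)).comp θ
          (((hasDerivAt_id θ).const_add z).sub ((hasDerivAt_rpow_of_pos q hθ.1).const_mul c))
        exact h1.congr_deriv (by ring))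
      (hint3.sub (hint1.const_mul c))
    simpa using h
  have hz : (∫ θ in 0..Real.pi, N (z + θ)) =
      (∫ t in 0..(z + Real.pi), N t) - ∫ t in 0..z, N t := by
    rw [intervalIntegral.integral_comp_add_left (fun t => N t), add_zero,
      intervalIntegral.integral_interval_sub_left (hNc.intervalIntegrable _ _)
        (hNc.intervalIntegrable _ _)]
  -- Three errors remain: the linearization of the primitive at each endpoint, and the oscillation
  -- of `N` against the weight. Each is at most `A * S ^ a * S`, whence the factor 3.
  have hmain : (∫ θ in 0..Real.pi, (N (z + θ - c * θ ^ q) - N (z + θ))) +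
      c * powAvgDeriv q N z =
      ((∫ t in 0..(z + Real.pi - S), N t) - (∫ t in 0..(z + Real.pi), N t) +
        S * N (z + Real.pi)) -
      ((∫ t in 0..(z - c * 0 ^ q), N t) - (∫ t in 0..z, N t) + c * 0 ^ q * N z) +
      c * ∫ θ in 0..Real.pi, q * θ ^ (q - 1) * (N (z + θ - c * θ ^ q) - N (z + θ)) := by
    have e1 : (∫ θ in 0..Real.pi, q * θ ^ (q - 1) * (N (z + θ - c * θ ^ q) - N (z + θ))) =
        (∫ θ in 0..Real.pi, q * θ ^ (q - 1) * N (z + θ - c * θ ^ q)) -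
        ∫ θ in 0..Real.pi, q * θ ^ (q - 1) * N (z + θ) := by
      rw [← intervalIntegral.integral_sub hint1 hint2]
      simp only [mul_sub]
    rw [intervalIntegral.integral_sub hint3 (hint1.const_mul c),
      intervalIntegral.integral_const_mul] at hftc
    rw [intervalIntegral.integral_sub hint3 hint4, e1, hz, powAvgDeriv, hS]
    rw [hS] at hftc
    linear_combination hftc
  rw [hmain]
  have b1 := hprim (z + Real.pi) S hS0 le_rfl
  have b2 := hprim z (c * 0 ^ q) (hφ 0 le_rfl Real.pi_pos.le).1 (hφ 0 le_rfl Real.pi_pos.le).2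
  have b3 := abs_integral_mul_rpow_mul_le hq
    (f := fun θ => N (z + θ - c * θ ^ q) - N (z + θ)) (K := A * S ^ a) (fun θ h0 h1 => by
      refine hosc _ _ ?_
      rw [show z + θ - c * θ ^ q - (z + θ) = -(c * θ ^ q) by ring, abs_neg,
        abs_of_nonneg (hφ θ h0.le h1).1]
      exact (hφ θ h0.le h1).2)
  have b4 := mul_le_mul_of_nonneg_left b3 hc
  calc _ ≤ _ := (abs_add_le _ _).trans (add_le_add_left (abs_sub _ _) _)
    _ ≤ A * S ^ a * S + A * S ^ a * S + c * (Real.pi ^ q * (A * S ^ a)) := by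
      rw [abs_mul c, abs_of_nonneg hc]
      exact add_le_add (add_le_add b1 b2) b4
    _ = _ := by rw [hS]; ring

/-! ### The exponential weight -/

theorem abs_exp_sub_one_sub_le (x : ℝ) : |Real.exp x - 1 - x| ≤ x ^ 2 * Real.exp |x| := by
  have h := Complex.norm_exp_sub_sum_le_norm_mul_exp (x : ℂ) 2
  simp only [Finset.sum_range_succ, Finset.sum_range_zero, pow_zero, Nat.factorial, Nat.cast_one,
    div_one, zero_add, pow_one, mul_one, Complex.norm_real] at h
  have e : Complex.exp (x : ℂ) - (1 + (x : ℂ)) = ((Real.exp x - 1 - x : ℝ) : ℂ) := by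
    push_cast
    ring
  rw [e, Complex.norm_real, Real.norm_eq_abs, Real.norm_eq_abs, sq_abs] at h
  exact h

/-- The contribution of one half of the circle to the jump part of the adjoint applied to `1`. -/
theorem abs_integral_weighted_displaced_sub_le {N V : ℝ → ℝ} {A a q c M β B₁ B₂ V₁ : ℝ}
    (ha : 0 < a) (hA : 0 ≤ A) (hq : 0 ≤ q) (hc : 0 ≤ c) (hβ : 0 ≤ β) (hB₁ : 0 ≤ B₁)
    (hN : ∀ x y, |N y - N x| ≤ A * |y - x| ^ a) (hM : ∀ t, |N t| ≤ M) (hV : Continuous V) (z : ℝ)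
    (hV₁ : |V₁| ≤ B₁) (h₁ : ∀ s, 0 ≤ s → |V (z - s) - V z| ≤ B₁ * s)
    (h₂ : ∀ s, 0 ≤ s → |V (z - s) - V z + s * V₁| ≤ B₂ * s ^ 2) :
    |(∫ θ in 0..Real.pi, (Real.exp (-β * (V (z - c * θ ^ q) - V z)) * N (z + θ - c * θ ^ q)
        - N (z + θ))) + c * powAvgDeriv q N z - β * V₁ * (c * powAvg q N z)| ≤
      3 * A * (c * Real.pi ^ q) ^ a * (c * Real.pi ^ q)
      + Real.pi * (β * B₁ * (c * Real.pi ^ q) * (A * (c * Real.pi ^ q) ^ a))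
      + Real.pi * ((β * B₂ * (c * Real.pi ^ q) ^ 2 + (β * (B₁ * (c * Real.pi ^ q))) ^ 2 *
          Real.exp (β * (B₁ * (c * Real.pi ^ q)))) * M) := by
  have hNc := continuous_of_holder ha hN
  have hT := abs_integral_displaced_sub_le ha hA hq hc hN z
  set S := c * Real.pi ^ q with hS
  have hS0 : 0 ≤ S := mul_nonneg hc (Real.rpow_nonneg Real.pi_pos.le _)
  have hM0 : 0 ≤ M := (abs_nonneg _).trans (hM 0)
  have hφc : Continuous fun θ : ℝ => c * θ ^ q :=
    continuous_const.mul (continuous_rpow_of_nonneg hq)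
  have hφ : ∀ θ, 0 ≤ θ → θ ≤ Real.pi → 0 ≤ c * θ ^ q ∧ c * θ ^ q ≤ S := fun θ h0 h1 =>
    ⟨mul_nonneg hc (Real.rpow_nonneg h0 _),
      mul_le_mul_of_nonneg_left (rpow_le_pi_rpow hq h0 h1) hc⟩
  -- The sign of `B₂` is read off from the Taylor bound at `s = 1`.
  have hB₂ : 0 ≤ B₂ := by simpa using (abs_nonneg _).trans (h₂ 1 zero_le_one)
  -- Four pieces: the displacement of `N` alone, the linear part of the weight times the oscillation
  -- of `N`, the quadratic remainder of the weight, and the linear part of the weight times the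
  -- undisplaced `N`. The last is the main term; the first is a main term up to the displacement
  -- error.
  let g₁ : ℝ → ℝ := fun θ => N (z + θ - c * θ ^ q) - N (z + θ)
  let g₂ : ℝ → ℝ := fun θ => β * V₁ * (c * θ ^ q) * (N (z + θ - c * θ ^ q) - N (z + θ))
  let g₃ : ℝ → ℝ := fun θ => (Real.exp (-β * (V (z - c * θ ^ q) - V z)) - 1
    - β * V₁ * (c * θ ^ q)) * N (z + θ - c * θ ^ q)
  let g₄ : ℝ → ℝ := fun θ => β * V₁ * c * (θ ^ q * N (z + θ))
  have hd : Continuous fun θ => N (z + θ - c * θ ^ q) := by fun_prop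
  have hs : Continuous fun θ => N (z + θ) := by fun_prop
  have hw : Continuous fun θ : ℝ => Real.exp (-β * (V (z - c * θ ^ q) - V z)) := by fun_prop
  have c₁ : Continuous g₁ := hd.sub hs
  have c₂ : Continuous g₂ := (continuous_const.mul hφc).mul c₁
  have c₃ : Continuous g₃ := ((hw.sub continuous_const).sub (continuous_const.mul hφc)).mul hd
  have c₄ : Continuous g₄ := continuous_const.mul ((continuous_rpow_of_nonneg hq).mul hs)
  have hsplit : (∫ θ in 0..Real.pi, (Real.exp (-β * (V (z - c * θ ^ q) - V z)) *
      N (z + θ - c * θ ^ q) - N (z + θ))) =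
      (∫ θ in 0..Real.pi, g₁ θ) + (∫ θ in 0..Real.pi, g₂ θ) + (∫ θ in 0..Real.pi, g₃ θ) +
        β * V₁ * (c * powAvg q N z) := by
    have e4 : β * V₁ * (c * powAvg q N z) = ∫ θ in 0..Real.pi, g₄ θ := by
      rw [intervalIntegral.integral_const_mul, powAvg]
      ring
    have c₁₂ : Continuous fun θ => g₁ θ + g₂ θ := c₁.add c₂
    have c₁₂₃ : Continuous fun θ => g₁ θ + g₂ θ + g₃ θ := c₁₂.add c₃
    rw [e4, ← intervalIntegral.integral_add (c₁.intervalIntegrable _ _)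
      (c₂.intervalIntegrable _ _), ← intervalIntegral.integral_add
      (c₁₂.intervalIntegrable _ _) (c₃.intervalIntegrable _ _),
      ← intervalIntegral.integral_add (c₁₂₃.intervalIntegrable _ _)
      (c₄.intervalIntegrable _ _)]
    refine intervalIntegral.integral_congr fun θ _ => ?_
    simp only [g₁, g₂, g₃, g₄]
    ring
  rw [hsplit]
  have b2 : |∫ θ in 0..Real.pi, g₂ θ| ≤ Real.pi * (β * B₁ * S * (A * S ^ a)) := by
    refine abs_integral_le_pi_mul fun θ h0 h1 => ?_
    obtain ⟨p0, p1⟩ := hφ θ h0 h1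
    simp only [g₂]
    rw [abs_mul, abs_mul, abs_mul, abs_of_nonneg hβ, abs_of_nonneg p0]
    refine mul_le_mul (mul_le_mul (mul_le_mul_of_nonneg_left hV₁ hβ) p1 p0 (by positivity)) ?_
      (abs_nonneg _) (by positivity)
    refine (hN _ _).trans (mul_le_mul_of_nonneg_left (Real.rpow_le_rpow (abs_nonneg _) ?_ ha.le) hA)
    rw [show z + θ - c * θ ^ q - (z + θ) = -(c * θ ^ q) by ring, abs_neg, abs_of_nonneg p0]
    exact p1
  have b3 : |∫ θ in 0..Real.pi, g₃ θ| ≤ Real.pi * ((β * B₂ * S ^ 2 + (β * (B₁ * S)) ^ 2 *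
      Real.exp (β * (B₁ * S))) * M) := by
    refine abs_integral_le_pi_mul fun θ h0 h1 => ?_
    obtain ⟨p0, p1⟩ := hφ θ h0 h1
    simp only [g₃]
    rw [abs_mul]
    refine mul_le_mul ?_ (hM _) (abs_nonneg _) (by positivity)
    set s := c * θ ^ q with hs'
    set x := -β * (V (z - s) - V z) with hx
    have hxabs : |x| ≤ β * (B₁ * S) := by
      rw [hx, abs_mul, abs_neg, abs_of_nonneg hβ]
      exact mul_le_mul_of_nonneg_left
        ((h₁ s p0).trans (mul_le_mul_of_nonneg_left p1 hB₁)) hβ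
    have hlin : |x - β * V₁ * s| ≤ β * B₂ * S ^ 2 := by
      rw [show x - β * V₁ * s = -(β * (V (z - s) - V z + s * V₁)) by rw [hx]; ring, abs_neg,
        abs_mul, abs_of_nonneg hβ, mul_assoc β]
      refine mul_le_mul_of_nonneg_left ((h₂ s p0).trans ?_) hβ
      exact mul_le_mul_of_nonneg_left (pow_le_pow_left₀ p0 p1 2) hB₂
    have hexp : |Real.exp x - 1 - x| ≤ (β * (B₁ * S)) ^ 2 * Real.exp (β * (B₁ * S)) := by
      refine (abs_exp_sub_one_sub_le x).trans ?_
      refine mul_le_mul ?_ (Real.exp_le_exp.2 hxabs) (Real.exp_pos _).le (by positivity)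
      rw [← sq_abs]
      exact pow_le_pow_left₀ (abs_nonneg _) hxabs 2
    calc |Real.exp x - 1 - β * V₁ * s| = |(x - β * V₁ * s) + (Real.exp x - 1 - x)| := by
          congr 1; ring
      _ ≤ _ := (abs_add_le _ _).trans (add_le_add hlin hexp)
  calc _ = |((∫ θ in 0..Real.pi, g₁ θ) + c * powAvgDeriv q N z) + (∫ θ in 0..Real.pi, g₂ θ) +
        (∫ θ in 0..Real.pi, g₃ θ)| := by congr 1; ring
    _ ≤ _ := (abs_add_le _ _).trans (add_le_add ((abs_add_le _ _).trans (add_le_add hT b2)) b3)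

/-- First and second order Taylor bounds from bounds for the derivatives. -/
theorem abs_sub_add_mul_le {V V' V'' : ℝ → ℝ} {B₁ B₂ : ℝ} (h1 : ∀ z, HasDerivAt V (V' z) z)
    (h2 : ∀ z, HasDerivAt V' (V'' z) z) (hB₁ : ∀ z, |V' z| ≤ B₁) (hB₂ : ∀ z, |V'' z| ≤ B₂)
    (z s : ℝ) : |V (z - s) - V z| ≤ B₁ * |s| ∧ |V (z - s) - V z + s * V' z| ≤ B₂ * s ^ 2 := by
  have hlip : ∀ {f f' : ℝ → ℝ} {C : ℝ} {t : Set ℝ} (x y : ℝ), Convex ℝ t →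
      (∀ w, HasDerivAt f (f' w) w) → (∀ w ∈ t, |f' w| ≤ C) → x ∈ t → y ∈ t →
      |f y - f x| ≤ C * |y - x| := fun x y ht h hC hx hy =>
    ht.norm_image_sub_le_of_norm_hasDerivWithin_le (fun w _ => (h w).hasDerivWithinAt) hC hx hy
  have hsub : ∀ w ∈ segment ℝ z (z - s), |w - z| ≤ |s| := by
    intro w hw
    have := norm_sub_le_of_mem_segment hw
    simpa using this
  constructor
  · have := hlip z (z - s) convex_univ h1 (fun w _ => hB₁ w) (mem_univ _) (mem_univ _)
    simpa using this
  -- The mean value inequality for `V x - V' z * x` on the segment, where the derivative is at most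
  -- `B₂ * |s|`; the factor `1 / 2` of Taylor's formula is given up.
  · have hd : ∀ w, HasDerivAt (fun x => V x - V' z * x) (V' w - V' z) w := fun w => by
      exact ((h1 w).sub ((hasDerivAt_id w).const_mul (V' z))).congr_deriv (by simp)
    have h0 : 0 ≤ B₂ := (abs_nonneg _).trans (hB₂ 0)
    have := hlip (C := B₂ * |s|) z (z - s) (convex_segment z (z - s)) hd (fun w hw => by
      refine (hlip z w convex_univ h2 (fun w _ => hB₂ w) (mem_univ _) (mem_univ _)).trans ?_
      exact mul_le_mul_of_nonneg_left (hsub w hw) h0) (left_mem_segment _ _ _)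
      (right_mem_segment _ _ _)
    rw [show z - s - z = -s by ring, abs_neg, mul_assoc, ← sq, sq_abs] at this
    convert this using 2
    ring

/-! ### Integration over the circle -/

theorem integral_unif (g : Torus → ℝ) :
    ∫ x, g x ∂unif = (2 * Real.pi)⁻¹ * ∫ t in (-Real.pi)..Real.pi, g (t : Torus) := by
  have h := AddCircle.intervalIntegral_preimage (2 * Real.pi) (-Real.pi) g
  rw [show -Real.pi + 2 * Real.pi = Real.pi by ring, AddCircle.volume_eq_smul_haarAddCircle,
    integral_smul_measure, ENNReal.toReal_ofReal Real.two_pi_pos.le, smul_eq_mul] at h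
  rw [h, inv_mul_cancel_left₀ Real.two_pi_pos.ne']

/-- Integration over the circle by the two halves at either side of `0`. -/
theorem integral_unif_of_halves {g : Torus → ℝ} {g₁ g₂ : ℝ → ℝ} (h₁ : Continuous g₁)
    (h₂ : Continuous g₂) (e₁ : ∀ θ : ℝ, 0 < θ → θ < Real.pi → g (θ : Torus) = g₁ θ)
    (e₂ : ∀ θ : ℝ, 0 < θ → θ < Real.pi → g ((-θ : ℝ) : Torus) = g₂ θ) :
    ∫ x, g x ∂unif = (2 * Real.pi)⁻¹ *
      ((∫ θ in 0..Real.pi, g₁ θ) + ∫ θ in 0..Real.pi, g₂ θ) := by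
  have hp := Real.pi_pos
  -- Open intervals suffice: at `0` and `±π` the direction of the jump is discontinuous, but these
  -- points are null.
  have q₁ : EqOn g₁ (fun t : ℝ => g (t : Torus)) (uIoo 0 Real.pi) := fun t ht => by
    rw [uIoo_of_le hp.le] at ht
    exact (e₁ t ht.1 ht.2).symm
  have q₂ : EqOn (fun t => g₂ (-t)) (fun t : ℝ => g (t : Torus)) (uIoo (-Real.pi) 0) :=
    fun t ht => by
      rw [uIoo_of_le (by linarith)] at ht
      simpa using (e₂ (-t) (by linarith [ht.2]) (by linarith [ht.1])).symm
  have i₁ := (h₁.intervalIntegrable (μ := volume) 0 Real.pi).congr_uIoo q₁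
  have i₂ := ((h₂.comp continuous_neg).intervalIntegrable (μ := volume) (-Real.pi) 0).congr_uIoo q₂
  rw [integral_unif, ← intervalIntegral.integral_add_adjacent_intervals i₂ i₁,
    ← intervalIntegral.integral_congr_uIoo q₁, ← intervalIntegral.integral_congr_uIoo q₂,
    intervalIntegral.integral_comp_neg, neg_zero, neg_neg, add_comm]

theorem norm_coe_of_abs_le {θ : ℝ} (h : |θ| ≤ Real.pi) : ‖(θ : Torus)‖ = |θ| := by
  rw [AddCircle.norm_coe_eq_abs_iff _ Real.two_pi_pos.ne', abs_of_pos Real.two_pi_pos]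
  linarith

theorem rep_coe {θ : ℝ} (h₁ : -Real.pi < θ) (h₂ : θ ≤ Real.pi) : rep (θ : Torus) = θ :=
  AddCircle.equivIoc_coe_of_mem ⟨h₁, by linarith⟩

theorem dist_coe_le (x y : ℝ) : dist (x : Torus) (y : Torus) ≤ |x - y| := by
  rw [dist_eq_norm, ← AddCircle.coe_sub]
  exact QuotientAddGroup.norm_mk_le_norm

theorem dist_le_pi (x y : Torus) : dist x y ≤ Real.pi := by
  rw [dist_eq_norm]
  have := AddCircle.norm_le_half_period (2 * Real.pi) Real.two_pi_pos.ne' (x := x - y)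
  rw [abs_of_pos Real.two_pi_pos] at this
  linarith

theorem periodic_deriv {f : ℝ → ℝ} {T : ℝ} (hf : Function.Periodic f T) :
    Function.Periodic (deriv f) T := fun x => by
  rw [← deriv_comp_add_const, show (fun x => f (x + T)) = f from funext hf]

/-- Two integrations by parts; the boundary terms cancel because the lifts and their first
derivatives are periodic. -/
theorem integral_mul_secondDeriv_comm (f g : C2) :
    ∫ x, (f : C(Torus, ℝ)) x * secondDeriv (g : C(Torus, ℝ)) x ∂unif =
      ∫ x, secondDeriv (f : C(Torus, ℝ)) x * (g : C(Torus, ℝ)) x ∂unif := by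
  set F : ℝ → ℝ := fun t => (f : C(Torus, ℝ)) (t : Torus) with hF
  set G : ℝ → ℝ := fun t => (g : C(Torus, ℝ)) (t : Torus) with hG
  have per : ∀ k : Torus → ℝ, Function.Periodic (fun t : ℝ => k (t : Torus)) (2 * Real.pi) :=
    fun k t => by simp
  have hFc : ContDiff ℝ 2 F := f.2
  have hGc : ContDiff ℝ 2 G := g.2
  have two : ∀ {H : ℝ → ℝ}, ContDiff ℝ 2 H → (∀ t, HasDerivAt H (deriv H t) t) ∧
      (∀ t, HasDerivAt (deriv H) (iteratedDeriv 2 H t) t) ∧ Continuous (deriv H) ∧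
      Continuous (iteratedDeriv 2 H) := fun {H} h => by
    have h1 : ContDiff ℝ 1 (deriv H) := ((contDiff_succ_iff_deriv (n := 1)).1 h).2.2
    refine ⟨fun t => (h.differentiable (by norm_num) t).hasDerivAt, fun t => ?_, h1.continuous,
      h.continuous_iteratedDeriv 2 le_rfl⟩
    rw [iteratedDeriv_succ, iteratedDeriv_one]
    exact (h1.differentiable (by norm_num) t).hasDerivAt
  obtain ⟨f1, f2, f3, f4⟩ := two hFc
  obtain ⟨g1, g2, g3, g4⟩ := two hGc
  have bdry : ∀ {H : ℝ → ℝ}, Function.Periodic H (2 * Real.pi) → H (-Real.pi) = H Real.pi :=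
    fun {H} h => by rw [← h (-Real.pi)]; congr 1; ring
  have bF := bdry (per (f : C(Torus, ℝ)))
  have bG := bdry (per (g : C(Torus, ℝ)))
  have bF' := bdry (periodic_deriv (per (f : C(Torus, ℝ))))
  have bG' := bdry (periodic_deriv (per (g : C(Torus, ℝ))))
  have a1 := intervalIntegral.integral_mul_deriv_eq_deriv_mul (a := -Real.pi) (b := Real.pi)
    (fun x _ => f1 x) (fun x _ => g2 x) (f3.intervalIntegrable _ _) (g4.intervalIntegrable _ _)
  have a2 := intervalIntegral.integral_mul_deriv_eq_deriv_mul (a := -Real.pi) (b := Real.pi)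
    (fun x _ => f2 x) (fun x _ => g1 x) (f4.intervalIntegrable _ _) (g3.intervalIntegrable _ _)
  rw [integral_unif, integral_unif]
  simp only [secondDeriv_coe]
  congr 1
  change ∫ x in (-Real.pi)..Real.pi, F x * iteratedDeriv 2 G x =
    ∫ x in (-Real.pi)..Real.pi, iteratedDeriv 2 F x * G x
  simp only [← hF, ← hG] at bF bG bF' bG'
  change F (-Real.pi) = F Real.pi at bF
  change G (-Real.pi) = G Real.pi at bG
  rw [a1]
  rw [bF', bG] at a2
  rw [bF, bG']
  linarith

/-! ### Densities -/

section density

variable {n : Torus → ℝ} {a A : ℝ} {ν : Measure Torus}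

theorem lift_holder (ha : 0 < a) (hA : 0 ≤ A) (hn : ∀ x y, |n y - n x| ≤ A * dist x y ^ a)
    (x y : ℝ) : |n (y : Torus) - n (x : Torus)| ≤ A * |y - x| ^ a :=
  (hn _ _).trans (mul_le_mul_of_nonneg_left
    (Real.rpow_le_rpow dist_nonneg (by rw [abs_sub_comm]; exact dist_coe_le x y) ha.le) hA)

theorem continuous_of_lift {X : Type*} [TopologicalSpace X] {f : Torus → X}
    (h : Continuous fun t : ℝ => f (t : Torus)) : Continuous f :=
  (QuotientAddGroup.isQuotientMap_mk (N := AddSubgroup.zmultiples (2 * Real.pi))).continuous_iff.2 h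

theorem integral_eq_integral_density (hn0 : ∀ x, 0 ≤ n x) (hnc : Continuous n)
    (hν : ν = unif.withDensity (fun x => ENNReal.ofReal (n x))) (g : Torus → ℝ) :
    ∫ x, g x ∂ν = ∫ x, n x * g x ∂unif := by
  have hm : Measurable fun x => ENNReal.ofReal (n x) := hnc.measurable.ennreal_ofReal
  rw [hν, integral_withDensity_eq_integral_toReal_smul hm (by simp)]
  simp only [ENNReal.toReal_ofReal (hn0 _), smul_eq_mul]

/-- The density has mean 1 and oscillation at most `A * π ^ a ≤ A * π`. The bound is free of `a` and
`ν`, which makes the final constant depend only on `A` and `p`. -/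
theorem density_le [IsProbabilityMeasure ν] (ha : 0 < a) (ha1 : a ≤ 1) (hA : 0 ≤ A)
    (hn0 : ∀ x, 0 ≤ n x) (hn : ∀ x y, |n y - n x| ≤ A * dist x y ^ a) (hnc : Continuous n)
    (hν : ν = unif.withDensity (fun x => ENNReal.ofReal (n x))) (x : Torus) :
    n x ≤ 1 + A * Real.pi := by
  have h1 : ∫ y, n y ∂unif = 1 := by
    have := integral_eq_integral_density hn0 hnc hν (fun _ => 1)
    simpa using this.symm
  have hd : ∀ y, n x - A * Real.pi ≤ n y := fun y => by
    have hpi : (1 : ℝ) ≤ Real.pi := by linarith [Real.pi_gt_three]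
    have : dist x y ^ a ≤ Real.pi :=
      (Real.rpow_le_rpow dist_nonneg (dist_le_pi x y) ha.le).trans
        (by simpa using Real.rpow_le_rpow_of_exponent_le hpi ha1)
    have := (hn x y).trans (mul_le_mul_of_nonneg_left this hA)
    linarith [(abs_le.1 this).1]
  have h2 := integral_mono (μ := unif) (integrable_const (n x - A * Real.pi))
    (hnc.integrable_of_hasCompactSupport (HasCompactSupport.of_compactSpace n)) hd
  rw [h1] at h2
  simp at h2
  linarith

end density

/-! ### The potential on the line -/

/-- The lift of the potential with density `N`. -/
def liftPot (p : ℝ) (N : ℝ → ℝ) (u : ℝ) : ℝ :=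
  (2 * Real.pi)⁻¹ * (powAvg p N u + powAvg p (fun t => N (-t)) (-u))

/-- The first derivative of `liftPot`. -/
def liftPotDeriv (p : ℝ) (N : ℝ → ℝ) (u : ℝ) : ℝ :=
  -(p / (2 * Real.pi)) * (powAvg (p - 1) N u - powAvg (p - 1) (fun t => N (-t)) (-u))

/-- The second derivative of `liftPot`. -/
def liftPotDeriv2 (p : ℝ) (N : ℝ → ℝ) (u : ℝ) : ℝ :=
  -(p / (2 * Real.pi)) * (powAvgDeriv (p - 1) N u + powAvgDeriv (p - 1) (fun t => N (-t)) (-u))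

/-- Translation by `u` centres the integral at the base point, and the clockwise half becomes an
integral over `0 < θ < π` for the reflected density at `-u`. -/
theorem potential_coe {p : ℝ} (hp : 0 < p) {n : Torus → ℝ} {ν : Measure Torus}
    (hn0 : ∀ x, 0 ≤ n x) (hnc : Continuous n)
    (hν : ν = unif.withDensity (fun x => ENNReal.ofReal (n x))) (u : ℝ) :
    potential p ν (u : Torus) = liftPot p (fun t => n (t : Torus)) u := by
  have hl : Continuous fun t : ℝ => n (t : Torus) := hnc.comp (AddCircle.continuous_mk' _)
  have hr := continuous_rpow_of_nonneg hp.le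
  rw [potential, integral_eq_integral_density hn0 hnc hν,
    ← integral_add_left_eq_self (μ := unif) _ (u : Torus), liftPot, powAvg, powAvg]
  refine integral_unif_of_halves (hr.mul (hl.comp (continuous_const.add continuous_id)))
    (hr.mul (hl.comp (by fun_prop))) (fun θ h0 h1 => ?_) (fun θ h0 h1 => ?_)
  · rw [dist_self_add_right, norm_coe_of_abs_le (by rw [abs_of_pos h0]; exact h1.le),
      abs_of_pos h0, mul_comm]
    simp
  · rw [dist_self_add_right, norm_coe_of_abs_le (by rw [abs_neg, abs_of_pos h0]; exact h1.le),
      abs_neg, abs_of_pos h0, mul_comm, ← AddCircle.coe_add]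
    congr 3
    ring

section lift

variable {p M : ℝ} {N : ℝ → ℝ}

/-- The boundary terms of the two halves both lie at the antipode `u + π`; by periodicity they are
equal, and the reflection gives them opposite signs. In the second derivative they add up instead,
which is the contribution of the cut locus. -/
theorem hasDerivAt_liftPot (hp : 1 ≤ p) (hN : Continuous N) (hM : ∀ t, |N t| ≤ M)
    (hper : Function.Periodic N (2 * Real.pi)) (u : ℝ) :
    HasDerivAt (liftPot p N) (liftPotDeriv p N u) u := by
  have h1 := hasDerivAt_powAvg (q := p) (by linarith) hN hM u
  have h2 := (hasDerivAt_powAvg (q := p) (by linarith) (hN.comp continuous_neg)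
    (fun t => hM (-t)) (-u)).comp u (hasDerivAt_neg u)
  refine ((h1.add h2).const_mul (2 * Real.pi)⁻¹).congr_deriv ?_
  have e : ∀ (K : ℝ → ℝ) (z : ℝ), powAvgDeriv p K z =
      Real.pi ^ p * K (z + Real.pi) - p * powAvg (p - 1) K z := fun K z => by
    rw [powAvgDeriv, powAvg, Real.zero_rpow (by linarith), zero_mul, sub_zero,
      ← intervalIntegral.integral_const_mul]
    simp only [mul_assoc]
  have hb : N (-(-u + Real.pi)) = N (u + Real.pi) := by
    rw [← hper (-(-u + Real.pi))]
    congr 1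
    ring
  rw [e, e, liftPotDeriv]
  simp only [Function.comp_apply, hb]
  simp only [Function.comp_def]
  field_simp
  ring

theorem hasDerivAt_liftPotDeriv (hp : 1 ≤ p) (hN : Continuous N) (hM : ∀ t, |N t| ≤ M) (u : ℝ) :
    HasDerivAt (liftPotDeriv p N) (liftPotDeriv2 p N u) u := by
  have h1 := hasDerivAt_powAvg (q := p - 1) (by linarith) hN hM u
  have h2 := (hasDerivAt_powAvg (q := p - 1) (by linarith) (hN.comp continuous_neg)
    (fun t => hM (-t)) (-u)).comp u (hasDerivAt_neg u)
  refine ((h1.sub h2).const_mul (-(p / (2 * Real.pi)))).congr_deriv ?_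
  rw [liftPotDeriv2]
  simp only [Function.comp_def]
  ring

theorem continuous_liftPotDeriv2 (hp : 1 ≤ p) (hN : Continuous N) (hM : ∀ t, |N t| ≤ M) :
    Continuous (liftPotDeriv2 p N) :=
  continuous_const.mul ((continuous_powAvgDeriv (by linarith) hN hM).add
    ((continuous_powAvgDeriv (q := p - 1) (by linarith) (hN.comp continuous_neg)
      (fun t => hM (-t))).comp continuous_neg))

theorem abs_liftPotDeriv_le (hp : 1 ≤ p) (hM : ∀ t, |N t| ≤ M) (u : ℝ) :
    |liftPotDeriv p N u| ≤ p * Real.pi ^ (p - 1) * M := by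
  have h1 := abs_powAvg_le (q := p - 1) (by linarith) hM u
  have h2 := abs_powAvg_le (q := p - 1) (by linarith) (N := fun t => N (-t))
    (fun t => hM (-t)) (-u)
  have hpos : 0 ≤ p / (2 * Real.pi) := by positivity
  rw [liftPotDeriv, abs_mul, abs_neg, abs_of_nonneg hpos]
  refine (mul_le_mul_of_nonneg_left ((abs_sub _ _).trans (add_le_add h1 h2)) hpos).trans_eq ?_
  field_simp
  ring

theorem abs_liftPotDeriv2_le (hp : 1 ≤ p) (hM : ∀ t, |N t| ≤ M) (u : ℝ) :
    |liftPotDeriv2 p N u| ≤ 3 * p * Real.pi ^ (p - 1) * M := by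
  have h1 := abs_powAvgDeriv_le (q := p - 1) (by linarith) hM u
  have h2 := abs_powAvgDeriv_le (q := p - 1) (by linarith) (N := fun t => N (-t))
    (fun t => hM (-t)) (-u)
  have hpos : 0 ≤ p / (2 * Real.pi) := by positivity
  have hM0 : 0 ≤ M := (abs_nonneg _).trans (hM 0)
  rw [liftPotDeriv2, abs_mul, abs_neg, abs_of_nonneg hpos]
  refine (mul_le_mul_of_nonneg_left ((abs_add_le _ _).trans (add_le_add h1 h2)) hpos).trans ?_
  have hX : 0 ≤ p * Real.pi ^ (p - 1) * M := by positivity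
  have : p / (2 * Real.pi) * (3 * (Real.pi ^ (p - 1) * M) + 3 * (Real.pi ^ (p - 1) * M)) =
      3 * (p * Real.pi ^ (p - 1) * M) / Real.pi := by
    field_simp
    ring
  rw [this, div_le_iff₀ Real.pi_pos]
  nlinarith [Real.pi_gt_three]

end lift

theorem contDiff_two_of_hasDerivAt {f f' f'' : ℝ → ℝ} (h1 : ∀ t, HasDerivAt f (f' t) t)
    (h2 : ∀ t, HasDerivAt f' (f'' t) t) (hc : Continuous f'') :
    ContDiff ℝ 2 f ∧ ∀ t, iteratedDeriv 2 f t = f'' t := by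
  have e1 : deriv f = f' := funext fun t => (h1 t).deriv
  have e2 : deriv f' = f'' := funext fun t => (h2 t).deriv
  constructor
  · refine (contDiff_succ_iff_deriv (n := 1)).2 ⟨fun t => (h1 t).differentiableAt, by simp, ?_⟩
    rw [e1]
    exact contDiff_one_iff_deriv.2 ⟨fun t => (h2 t).differentiableAt, by rwa [e2]⟩
  · intro t
    rw [iteratedDeriv_succ, iteratedDeriv_one, e1, e2]

/-! ### The adjoint applied to `1` -/

/-- The jump of the algorithm as a function of the displacement `w = y - x`. -/
def jumpShift (p c : ℝ) (w : Torus) : Torus :=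
  (((SignType.sign (rep w) : ℝ) * (c * ‖w‖ ^ (p - 1)) : ℝ) : Torus)

/-- The jump is a translation by an amount that depends on `y - x` alone, which is what makes the
dual explicit. -/
theorem geod_add (p c : ℝ) (x w : Torus) :
    geod x (x + w) (c * dist x (x + w) ^ (p - 1)) = x + jumpShift p c w := by
  rw [geod, jumpShift, add_sub_cancel_left, dist_self_add_right]

theorem measurable_jumpShift (p c : ℝ) : Measurable (jumpShift p c) := by
  have h := measurable_geod (x := fun _ : Torus => (0 : Torus)) (y := fun w => w)
    (t := fun w => c * ‖w‖ ^ (p - 1)) measurable_const measurable_id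
    ((measurable_norm.pow_const _).const_mul c)
  simp only [geod, zero_add, sub_zero] at h
  exact h

theorem jumpShift_coe (p c : ℝ) {θ : ℝ} (h0 : 0 < θ) (h1 : θ < Real.pi) :
    jumpShift p c (θ : Torus) = ((c * θ ^ (p - 1) : ℝ) : Torus) := by
  rw [jumpShift, rep_coe (by linarith) h1.le, sign_pos h0,
    norm_coe_of_abs_le (by rw [abs_of_pos h0]; exact h1.le), abs_of_pos h0]
  simp

theorem jumpShift_coe_neg (p c : ℝ) {θ : ℝ} (h0 : 0 < θ) (h1 : θ < Real.pi) :
    jumpShift p c ((-θ : ℝ) : Torus) = -((c * θ ^ (p - 1) : ℝ) : Torus) := by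
  rw [jumpShift, rep_coe (by linarith) (by linarith), sign_neg (by linarith),
    norm_coe_of_abs_le (by rw [abs_neg, abs_of_pos h0]; exact h1.le), abs_neg, abs_of_pos h0]
  simp

/-- The integral of the jump part of the generator, acting on densities. -/
def jumpDual (p c : ℝ) (n E : Torus → ℝ) (z : Torus) : ℝ :=
  ∫ w, (E (z - jumpShift p c w) * n (z - jumpShift p c w + w) - E z * n (z + w)) ∂unif

theorem measurable_jumpDual_integrand (p c : ℝ) {n E : Torus → ℝ} (hn : Continuous n)
    (hE : Continuous E) : Measurable fun x : Torus × Torus =>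
      E (x.1 - jumpShift p c x.2) * n (x.1 - jumpShift p c x.2 + x.2) - E x.1 * n (x.1 + x.2) := by
  have h1 : Measurable fun x : Torus × Torus => x.1 - jumpShift p c x.2 :=
    measurable_fst.sub ((measurable_jumpShift p c).comp measurable_snd)
  exact ((hE.measurable.comp h1).mul (hn.measurable.comp (h1.add measurable_snd))).sub
    ((hE.measurable.comp measurable_fst).mul
      (hn.measurable.comp (measurable_fst.add measurable_snd)))

theorem measurable_jumpDual (p c : ℝ) {n E : Torus → ℝ} (hn : Continuous n) (hE : Continuous E) :
    Measurable (jumpDual p c n E) :=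
  (measurable_jumpDual_integrand p c hn hE).stronglyMeasurable.integral_prod_right'.measurable

theorem exists_abs_le_of_continuous {f : Torus → ℝ} (hf : Continuous f) :
    ∃ K, 0 ≤ K ∧ ∀ x, |f x| ≤ K :=
  ⟨‖(⟨f, hf⟩ : C(Torus, ℝ))‖, norm_nonneg _, fun x =>
    (⟨f, hf⟩ : C(Torus, ℝ)).norm_coe_le_norm x⟩

/-- Duality of the jump part with respect to the uniform measure. -/
theorem integral_mul_jump_eq {p c : ℝ} {n E f : Torus → ℝ} (hn : Continuous n)
    (hE : Continuous E) (hf : Continuous f) :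
    ∫ x, E x * ∫ w, n (x + w) * (f (x + jumpShift p c w) - f x) ∂unif ∂unif =
      ∫ z, f z * jumpDual p c n E z ∂unif := by
  obtain ⟨Kn, Kn0, hKn⟩ := exists_abs_le_of_continuous hn
  obtain ⟨KE, KE0, hKE⟩ := exists_abs_le_of_continuous hE
  obtain ⟨Kf, Kf0, hKf⟩ := exists_abs_le_of_continuous hf
  have hx : Measurable (Prod.fst : Torus × Torus → Torus) := measurable_fst
  have hw : Measurable (Prod.snd : Torus × Torus → Torus) := measurable_snd
  have hJ := (measurable_jumpShift p c).comp hw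
  -- The three integrability facts serve Fubini's theorem. As `jumpShift` is discontinuous in `w`,
  -- they come from measurability and boundedness rather than continuity.
  have i₁ : Integrable (Function.uncurry fun x w : Torus =>
      E x * n (x + w) * f (x + jumpShift p c w)) (unif.prod unif) := by
    refine Integrable.of_bound (((hE.measurable.comp hx).mul
      (hn.measurable.comp (hx.add hw))).mul
      (hf.measurable.comp (hx.add hJ))).aestronglyMeasurable (KE * Kn * Kf)
      (Filter.Eventually.of_forall fun x => ?_)
    simp only [Function.uncurry, norm_mul]
    exact mul_le_mul (mul_le_mul (hKE _) (hKn _) (norm_nonneg _) KE0) (hKf _) (norm_nonneg _)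
      (mul_nonneg KE0 Kn0)
  have i₂ : Integrable (Function.uncurry fun x w : Torus => E x * n (x + w) * f x)
      (unif.prod unif) := by
    refine Integrable.of_bound (((hE.measurable.comp hx).mul
      (hn.measurable.comp (hx.add hw))).mul (hf.measurable.comp hx)).aestronglyMeasurable
      (KE * Kn * Kf) (Filter.Eventually.of_forall fun x => ?_)
    simp only [Function.uncurry, norm_mul]
    exact mul_le_mul (mul_le_mul (hKE _) (hKn _) (norm_nonneg _) KE0) (hKf _) (norm_nonneg _)
      (mul_nonneg KE0 Kn0)
  have i₃ : Integrable (Function.uncurry fun z w : Torus => f z *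
      (E (z - jumpShift p c w) * n (z - jumpShift p c w + w) - E z * n (z + w)))
      (unif.prod unif) := by
    refine Integrable.of_bound ((hf.measurable.comp hx).mul
      (measurable_jumpDual_integrand p c hn hE)).aestronglyMeasurable
      (Kf * (KE * Kn + KE * Kn)) (Filter.Eventually.of_forall fun x => ?_)
    simp only [Function.uncurry, norm_mul]
    refine mul_le_mul (hKf _) ((norm_sub_le _ _).trans (add_le_add ?_ ?_)) (norm_nonneg _) Kf0
    all_goals
      rw [norm_mul]
      exact mul_le_mul (hKE _) (hKn _) (norm_nonneg _) KE0
  calc _ = ∫ x, ∫ w, (E x * n (x + w) * f (x + jumpShift p c w) - E x * n (x + w) * f x)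
          ∂unif ∂unif := by
        refine integral_congr_ae (Filter.Eventually.of_forall fun x => ?_)
        simp only
        rw [← integral_const_mul]
        refine integral_congr_ae (Filter.Eventually.of_forall fun w => ?_)
        simp only
        ring
    _ = ∫ w, ∫ x, (E x * n (x + w) * f (x + jumpShift p c w) - E x * n (x + w) * f x)
          ∂unif ∂unif := integral_integral_swap (i₁.sub i₂)
    _ = ∫ w, ∫ z, f z * (E (z - jumpShift p c w) * n (z - jumpShift p c w + w) - E z * n (z + w))
          ∂unif ∂unif := by
        refine integral_congr_ae (Filter.Eventually.of_forall fun w => ?_)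
        simp only
        have hc : ∀ {k : Torus → ℝ}, Continuous k → Integrable k unif := fun hk =>
          hk.integrable_of_hasCompactSupport (HasCompactSupport.of_compactSpace _)
        -- For fixed `w` the jump is one translation of the whole circle, so the substitution `z = x
        -- + jumpShift p c w` preserves the measure.
        have t := integral_sub_right_eq_self (μ := unif)
          (fun x => E x * n (x + w) * f (x + jumpShift p c w)) (jumpShift p c w)
        rw [integral_sub (hc (by fun_prop)) (hc (by fun_prop)), ← t,
          ← integral_sub (hc (by fun_prop)) (hc (by fun_prop))]
        refine integral_congr_ae (Filter.Eventually.of_forall fun z => ?_)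
        simp only [sub_add_cancel]
        ring
    _ = ∫ z, ∫ w, f z * (E (z - jumpShift p c w) * n (z - jumpShift p c w + w) - E z * n (z + w))
          ∂unif ∂unif := (integral_integral_swap i₃).symm
    _ = _ := by
        refine integral_congr_ae (Filter.Eventually.of_forall fun z => ?_)
        simp only [jumpDual]
        rw [integral_const_mul]

theorem genFun_eq {p α β : ℝ} {n : Torus → ℝ} {ν : Measure Torus} (hn0 : ∀ x, 0 ≤ n x)
    (hnc : Continuous n) (hν : ν = unif.withDensity (fun x => ENNReal.ofReal (n x)))
    (f : Torus → ℝ) (x : Torus) :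
    genFun p α β ν f x = 1 / 2 * secondDeriv f x + 1 / α *
      ∫ w, n (x + w) * (f (x + jumpShift p (p / 2 * β * α) w) - f x) ∂unif := by
  rw [genFun, integral_eq_integral_density hn0 hnc hν,
    ← integral_add_left_eq_self (μ := unif) _ x]
  simp only [geod_add]

/-- Duality of the generator with respect to the uniform measure. -/
theorem integral_mul_genFun_eq {p α β : ℝ} {n : Torus → ℝ} {ν : Measure Torus}
    [IsProbabilityMeasure ν] (hn0 : ∀ x, 0 ≤ n x)
    (hnc : Continuous n) (hν : ν = unif.withDensity (fun x => ENNReal.ofReal (n x)))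
    (E f : C2) :
    ∫ x, (E : C(Torus, ℝ)) x * genFun p α β ν (f : C(Torus, ℝ)) x ∂unif =
      ∫ z, (f : C(Torus, ℝ)) z * (1 / 2 * secondDeriv (E : C(Torus, ℝ)) z +
        1 / α * jumpDual p (p / 2 * β * α) n (E : C(Torus, ℝ)) z) ∂unif := by
  set Ef := (E : C(Torus, ℝ))
  set ff := (f : C(Torus, ℝ))
  have hdual := integral_mul_jump_eq (p := p) (c := p / 2 * β * α) hnc Ef.continuous ff.continuous
  have hc : ∀ {k : Torus → ℝ}, Continuous k → Integrable k unif := fun hk =>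
    hk.integrable_of_hasCompactSupport (HasCompactSupport.of_compactSpace _)
  obtain ⟨Kn, Kn0, hKn⟩ := exists_abs_le_of_continuous hnc
  obtain ⟨KE, KE0, hKE⟩ := exists_abs_le_of_continuous Ef.continuous
  obtain ⟨Kf, Kf0, hKf⟩ := exists_abs_le_of_continuous ff.continuous
  have i₁ : Integrable (fun x => Ef x * genFun p α β ν ff x) unif := by
    obtain ⟨K, hK⟩ := exists_genFun_bound p α β ν f
    refine Integrable.of_bound (Ef.continuous.measurable.mul
      (measurable_genFun p α β ν f)).aestronglyMeasurable (KE * K)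
      (Filter.Eventually.of_forall fun x => ?_)
    rw [norm_mul]
    exact mul_le_mul (hKE x) (hK x) (norm_nonneg _) KE0
  have i₂ : Integrable (fun x => Ef x * (1 / 2 * secondDeriv ff x)) unif :=
    hc (Ef.continuous.mul (continuous_const.mul (continuous_secondDeriv f)))
  have i₃ : Integrable (fun z => ff z * (1 / 2 * secondDeriv Ef z)) unif :=
    hc (ff.continuous.mul (continuous_const.mul (continuous_secondDeriv E)))
  have i₄ : Integrable (fun z => ff z * (1 / α *
      jumpDual p (p / 2 * β * α) n Ef z)) unif := by
    refine Integrable.of_bound (ff.continuous.measurable.mul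
      ((measurable_jumpDual p _ hnc Ef.continuous).const_mul _)).aestronglyMeasurable
      (Kf * (|1 / α| * (KE * Kn + KE * Kn))) (Filter.Eventually.of_forall fun x => ?_)
    rw [norm_mul, norm_mul]
    refine mul_le_mul (hKf x) (mul_le_mul_of_nonneg_left ?_ (abs_nonneg _)) (by positivity) Kf0
    have := norm_integral_le_of_norm_le_const (μ := unif) (C := KE * Kn + KE * Kn)
      (f := fun w => Ef (x - jumpShift p (p / 2 * β * α) w) *
        n (x - jumpShift p (p / 2 * β * α) w + w) - Ef x * n (x + w))
      (Filter.Eventually.of_forall fun w => by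
        refine (norm_sub_le _ _).trans (add_le_add ?_ ?_)
        all_goals
          rw [norm_mul]
          exact mul_le_mul (hKE _) (hKn _) (norm_nonneg _) KE0)
    simpa [jumpDual] using this
  have e₁ : ∀ x, Ef x * genFun p α β ν ff x - Ef x * (1 / 2 * secondDeriv ff x) =
      1 / α * (Ef x *
        ∫ w, n (x + w) * (ff (x + jumpShift p (p / 2 * β * α) w) - ff x) ∂unif) := fun x => by
    rw [genFun_eq hn0 hnc hν]
    ring
  have s₁ := integral_sub i₁ i₂
  simp only [e₁] at s₁
  rw [integral_const_mul, hdual] at s₁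
  have s₂ := integral_add i₃ i₄
  have h1 : ∫ x, Ef x * (1 / 2 * secondDeriv ff x) ∂unif =
      ∫ z, ff z * (1 / 2 * secondDeriv Ef z) ∂unif := by
    have e : ∀ k l : Torus → ℝ, ∫ x, k x * (1 / 2 * l x) ∂unif = 1 / 2 * ∫ x, k x * l x ∂unif :=
      fun k l => by
        rw [← integral_const_mul]
        congr 1
        funext x
        ring
    rw [e, e, integral_mul_secondDeriv_comm f E]
    congr 2
    funext x
    ring
  have h2 : ∫ z, ff z * (1 / α * jumpDual p (p / 2 * β * α) n Ef z) ∂unif =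
      1 / α * ∫ z, ff z * jumpDual p (p / 2 * β * α) n Ef z ∂unif := by
    rw [← integral_const_mul]
    congr 1
    funext x
    ring
  have s₃ : ∫ z, ff z * (1 / 2 * secondDeriv Ef z + 1 / α * jumpDual p (p / 2 * β * α) n Ef z)
      ∂unif = ∫ z, (ff z * (1 / 2 * secondDeriv Ef z) +
        ff z * (1 / α * jumpDual p (p / 2 * β * α) n Ef z)) ∂unif := by
    simp only [mul_add]
  rw [s₃, s₂, h2]
  linarith

/-! ### The bound -/

/-- The constant in the bound for the adjoint applied to `1`, where `κ = p π ^ (p - 1) / 2`,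
`M` bounds the density, and `B₁`, `B₂` bound the derivatives of the potential. -/
def adjointConst (A κ M B₁ B₂ : ℝ) : ℝ :=
  3 * A * κ * (1 + κ) + Real.pi * B₁ * κ * A * (1 + κ) +
    Real.pi * M * κ ^ 2 * (B₂ + B₁ ^ 2 * Real.exp (κ * B₁))

/-- With `S = κ β α` the errors have orders `β ^ 2 α ^ (1 + a)`, `β ^ 3 α ^ (1 + a)` and `(β ^ 3 + β
^ 4) α ^ 2`. The fourth power of `β` comes from the quadratic remainder of the exponential. -/
theorem error_le_adjointConst {A κ M B₁ B₂ α β a : ℝ} (hA : 0 ≤ A) (hκ : 0 ≤ κ) (hM : 0 ≤ M)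
    (hB₁ : 0 ≤ B₁) (hB₂ : 0 ≤ B₂) (hα : 0 < α) (hβ : 1 ≤ β) (hαβ : α * β ^ 2 ≤ 1) (ha : 0 < a)
    (ha1 : a ≤ 1) :
    3 * A * (κ * β * α) ^ a * (κ * β * α)
      + Real.pi * (β * B₁ * (κ * β * α) * (A * (κ * β * α) ^ a))
      + Real.pi * ((β * B₂ * (κ * β * α) ^ 2 + (β * (B₁ * (κ * β * α))) ^ 2 *
          Real.exp (β * (B₁ * (κ * β * α)))) * M) ≤
      α * (adjointConst A κ M B₁ B₂ * α ^ a * β ^ 4) := by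
  have hβ0 : 0 ≤ β := by linarith
  have hα1 : α ≤ 1 := by nlinarith [one_le_pow₀ hβ (n := 2)]
  have hαa : 0 ≤ α ^ a := Real.rpow_nonneg hα.le _
  have hpow : (κ * β * α) ^ a ≤ (1 + κ) * β * α ^ a := by
    rw [Real.mul_rpow (by positivity) hα.le, Real.mul_rpow hκ hβ0]
    refine mul_le_mul_of_nonneg_right (mul_le_mul ?_ ?_ (Real.rpow_nonneg hβ0 _) (by positivity))
      hαa
    · calc κ ^ a ≤ (1 + κ) ^ a := Real.rpow_le_rpow hκ (by linarith) ha.le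
        _ ≤ 1 + κ := by
          simpa using Real.rpow_le_rpow_of_exponent_le (by linarith : 1 ≤ 1 + κ) ha1
    · simpa using Real.rpow_le_rpow_of_exponent_le hβ ha1
  have hαle : α ≤ α ^ a := by
    simpa using Real.rpow_le_rpow_of_exponent_ge hα hα1 ha1
  -- The exponent is `κ * B₁ * (α * β ^ 2)`; here the smallness of `α β ²` keeps the exponential
  -- bounded as `β` grows.
  have hexp : Real.exp (β * (B₁ * (κ * β * α))) ≤ Real.exp (κ * B₁) := by
    rw [Real.exp_le_exp]
    have h0 : 0 ≤ κ * B₁ := mul_nonneg hκ hB₁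
    calc β * (B₁ * (κ * β * α)) = κ * B₁ * (α * β ^ 2) := by ring
      _ ≤ κ * B₁ * 1 := mul_le_mul_of_nonneg_left hαβ h0
      _ = _ := mul_one _
  have p2 : β ^ 2 ≤ β ^ 4 := pow_le_pow_right₀ hβ (by norm_num)
  have p3 : β ^ 3 ≤ β ^ 4 := pow_le_pow_right₀ hβ (by norm_num)
  have t1 : 3 * A * (κ * β * α) ^ a * (κ * β * α) ≤
      α * (3 * A * κ * (1 + κ) * α ^ a * β ^ 4) := by
    calc 3 * A * (κ * β * α) ^ a * (κ * β * α)
        ≤ 3 * A * ((1 + κ) * β * α ^ a) * (κ * β * α) := by gcongr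
      _ = α * (3 * A * κ * (1 + κ) * α ^ a * β ^ 2) := by ring
      _ ≤ _ := by gcongr
  have t2 : Real.pi * (β * B₁ * (κ * β * α) * (A * (κ * β * α) ^ a)) ≤
      α * (Real.pi * B₁ * κ * A * (1 + κ) * α ^ a * β ^ 4) := by
    calc Real.pi * (β * B₁ * (κ * β * α) * (A * (κ * β * α) ^ a))
        ≤ Real.pi * (β * B₁ * (κ * β * α) * (A * ((1 + κ) * β * α ^ a))) := by gcongr
      _ = α * (Real.pi * B₁ * κ * A * (1 + κ) * α ^ a * β ^ 3) := by ring
      _ ≤ _ := by gcongr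
  have t3 : Real.pi * ((β * B₂ * (κ * β * α) ^ 2 + (β * (B₁ * (κ * β * α))) ^ 2 *
          Real.exp (β * (B₁ * (κ * β * α)))) * M) ≤
      α * (Real.pi * M * κ ^ 2 * (B₂ + B₁ ^ 2 * Real.exp (κ * B₁)) * α ^ a * β ^ 4) := by
    calc Real.pi * ((β * B₂ * (κ * β * α) ^ 2 + (β * (B₁ * (κ * β * α))) ^ 2 *
          Real.exp (β * (B₁ * (κ * β * α)))) * M)
        ≤ Real.pi * ((β * B₂ * (κ * β * α) ^ 2 + (β * (B₁ * (κ * β * α))) ^ 2 *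
          Real.exp (κ * B₁)) * M) := by gcongr
      _ = α * (Real.pi * M * κ ^ 2 * (B₂ * β ^ 3 + B₁ ^ 2 * Real.exp (κ * B₁) * β ^ 4) * α) := by
        ring
      _ ≤ α * (Real.pi * M * κ ^ 2 * (B₂ * β ^ 4 + B₁ ^ 2 * Real.exp (κ * B₁) * β ^ 4) * α ^ a) := by
        gcongr
      _ = _ := by ring
  calc _ ≤ _ := add_le_add (add_le_add t1 t2) t3
    _ = _ := by rw [adjointConst]; ring

/-- The jump part of the adjoint in terms of the two halves of the circle. -/
theorem jumpDual_exp_coe {p β c : ℝ} {n U : Torus → ℝ} {V : ℝ → ℝ} (hp : 1 ≤ p)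
    (hn : Continuous n) (hV : Continuous V) (hU : ∀ t : ℝ, U (t : Torus) = V t) (u : ℝ) :
    jumpDual p c n (fun x => Real.exp (-β * U x)) (u : Torus) =
      Real.exp (-β * V u) * ((2 * Real.pi)⁻¹ *
      ((∫ θ in 0..Real.pi, (Real.exp (-β * (V (u - c * θ ^ (p - 1)) - V u)) *
          n ((u + θ - c * θ ^ (p - 1) : ℝ) : Torus) - n ((u + θ : ℝ) : Torus))) +
        ∫ θ in 0..Real.pi, (Real.exp (-β * (V (-(-u - c * θ ^ (p - 1))) - V (- -u))) *
          n ((-(-u + θ - c * θ ^ (p - 1)) : ℝ) : Torus) - n ((-(-u + θ) : ℝ) : Torus)))) := by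
  have hl : Continuous fun t : ℝ => n (t : Torus) := hn.comp (AddCircle.continuous_mk' _)
  have hr := continuous_rpow_of_nonneg (q := p - 1) (by linarith)
  have hs : ∀ x y : ℝ, Real.exp (-β * V y) = Real.exp (-β * V x) *
      Real.exp (-β * (V y - V x)) := fun x y => by
    rw [← Real.exp_add]
    congr 1
    ring
  rw [jumpDual, mul_left_comm, mul_add, ← intervalIntegral.integral_const_mul,
    ← intervalIntegral.integral_const_mul]
  refine integral_unif_of_halves (continuous_const.mul (((Real.continuous_exp.comp (by fun_prop)).mul
    (hl.comp (by fun_prop))).sub (hl.comp (by fun_prop))))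
    (continuous_const.mul (((Real.continuous_exp.comp (by fun_prop)).mul
    (hl.comp (by fun_prop))).sub (hl.comp (by fun_prop)))) (fun θ h0 h1 => ?_) (fun θ h0 h1 => ?_)
  · rw [jumpShift_coe p c h0 h1, ← AddCircle.coe_sub, ← AddCircle.coe_add, ← AddCircle.coe_add,
      hU, hU, hs u (u - _), show u - c * θ ^ (p - 1) + θ = u + θ - c * θ ^ (p - 1) by ring]
    ring
  · rw [jumpShift_coe_neg p c h0 h1, sub_neg_eq_add, ← AddCircle.coe_add, ← AddCircle.coe_add,
      ← AddCircle.coe_add, hU, hU, hs u (u + _), neg_neg,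
      show -(-u - c * θ ^ (p - 1)) = u + c * θ ^ (p - 1) by ring,
      show -(-u + θ - c * θ ^ (p - 1)) = u + c * θ ^ (p - 1) + -θ by ring,
      show -(-u + θ) = u + -θ by ring]
    ring

/-- The lift of the Gibbs weight is twice continuously differentiable. -/
theorem contDiff_exp_mul {V V' V'' : ℝ → ℝ} (β : ℝ) (h1 : ∀ z, HasDerivAt V (V' z) z)
    (h2 : ∀ z, HasDerivAt V' (V'' z) z) (hc : Continuous V'') :
    ContDiff ℝ 2 (fun t => Real.exp (-β * V t)) ∧
      ∀ t, iteratedDeriv 2 (fun t => Real.exp (-β * V t)) t =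
        Real.exp (-β * V t) * (β ^ 2 * V' t ^ 2 - β * V'' t) := by
  have d1 : ∀ t, HasDerivAt (fun t => Real.exp (-β * V t))
      (Real.exp (-β * V t) * (-β * V' t)) t := fun t => ((h1 t).const_mul (-β)).exp
  have d2 : ∀ t, HasDerivAt (fun t => Real.exp (-β * V t) * (-β * V' t))
      (Real.exp (-β * V t) * (β ^ 2 * V' t ^ 2 - β * V'' t)) t := fun t =>
    ((d1 t).mul ((h2 t).const_mul (-β))).congr_deriv (by ring)
  have c0 : Continuous V := continuous_iff_continuousAt.2 fun t => (h1 t).continuousAt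
  have c1 : Continuous V' := continuous_iff_continuousAt.2 fun t => (h2 t).continuousAt
  exact contDiff_two_of_hasDerivAt d1 d2 (by fun_prop)

/-- Sup bound of the adjoint of the generator applied to `1`, relative to the uniform measure. -/
theorem abs_adjoint_numerator_le {p α β a A M : ℝ} {n U : Torus → ℝ} (hp : 1 ≤ p) (ha : 0 < a)
    (ha1 : a ≤ 1) (hA : 0 ≤ A) (hα : 0 < α) (hβ : 1 ≤ β) (hαβ : α * β ^ 2 ≤ 1)
    (hn : ∀ x y, |n y - n x| ≤ A * dist x y ^ a) (hM : ∀ x, |n x| ≤ M)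
    (hU : ∀ t : ℝ, U (t : Torus) = liftPot p (fun t => n (t : Torus)) t) (x : Torus) :
    |1 / 2 * secondDeriv (fun x => Real.exp (-β * U x)) x +
      1 / α * jumpDual p (p / 2 * β * α) n (fun x => Real.exp (-β * U x)) x| ≤
    Real.exp (-β * U x) * (adjointConst A (p / 2 * Real.pi ^ (p - 1)) M
      (p * Real.pi ^ (p - 1) * M) (3 * p * Real.pi ^ (p - 1) * M) * α ^ a * β ^ 4) := by
  induction x using QuotientAddGroup.induction_on with
  | H u =>
  set N : ℝ → ℝ := fun t => n (t : Torus) with hNdef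
  have hNh := lift_holder ha hA hn
  have hNc : Continuous N := continuous_of_holder ha hNh
  have hnc : Continuous n := continuous_of_lift hNc
  have hNM : ∀ t, |N t| ≤ M := fun t => hM _
  have hM0 : 0 ≤ M := (abs_nonneg _).trans (hNM 0)
  have hper : Function.Periodic N (2 * Real.pi) := fun t => by simp [hNdef]
  have hβ0 : 0 ≤ β := by linarith
  have hq : 0 ≤ p - 1 := by linarith
  set V := liftPot p N
  set V' := liftPotDeriv p N with hV'
  set V'' := liftPotDeriv2 p N with hV''
  have d1 : ∀ z, HasDerivAt V (V' z) z := hasDerivAt_liftPot hp hNc hNM hper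
  have d2 : ∀ z, HasDerivAt V' (V'' z) z := hasDerivAt_liftPotDeriv hp hNc hNM
  have hVc : Continuous V := continuous_iff_continuousAt.2 fun t => (d1 t).continuousAt
  set B₁ := p * Real.pi ^ (p - 1) * M
  set B₂ := 3 * p * Real.pi ^ (p - 1) * M
  have b1 : ∀ z, |V' z| ≤ B₁ := abs_liftPotDeriv_le hp hNM
  have b2 : ∀ z, |V'' z| ≤ B₂ := abs_liftPotDeriv2_le hp hNM
  have hB₁ : 0 ≤ B₁ := (abs_nonneg _).trans (b1 0)
  have hB₂ : 0 ≤ B₂ := (abs_nonneg _).trans (b2 0)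
  set c := p / 2 * β * α with hc
  have hc0 : 0 ≤ c := by positivity
  have taylor := abs_sub_add_mul_le d1 d2 b1 b2 u
  have R := abs_integral_weighted_displaced_sub_le (V := V) (V₁ := V' u) (B₁ := B₁) (B₂ := B₂)
    ha hA hq hc0 hβ0 hB₁ hNh hNM hVc u (b1 u)
    (fun s hs => by simpa [abs_of_nonneg hs] using (taylor s).1) (fun s _ => (taylor s).2)
  -- The clockwise half is the same estimate for the reflected data at `-u`, where the derivative of
  -- the potential is `-V' u`.
  have L := abs_integral_weighted_displaced_sub_le (N := fun t => N (-t)) (V := fun t => V (-t))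
    (V₁ := -V' u) (B₁ := B₁) (B₂ := B₂) ha hA hq hc0 hβ0 hB₁
    (fun x y => (hNh (-x) (-y)).trans_eq (by
      rw [show -y - -x = -(y - x) by ring, abs_neg])) (fun t => hNM (-t))
    (hVc.comp continuous_neg) (-u) (by simpa using b1 u)
    (fun s hs => by simpa [abs_of_nonneg hs, add_comm] using (taylor (-s)).1)
    (fun s _ => by simpa [add_comm] using (taylor (-s)).2)
  have hS : c * Real.pi ^ (p - 1) = p / 2 * Real.pi ^ (p - 1) * β * α := by rw [hc]; ring
  rw [hS] at R L
  have err := error_le_adjointConst (κ := p / 2 * Real.pi ^ (p - 1)) hA (by positivity) hM0 hB₁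
    hB₂ hα hβ hαβ ha ha1
  set K := adjointConst A (p / 2 * Real.pi ^ (p - 1)) M B₁ B₂ * α ^ a * β ^ 4
  have hsec : secondDeriv (fun x => Real.exp (-β * U x)) (u : Torus) =
      Real.exp (-β * V u) * (β ^ 2 * V' u ^ 2 - β * V'' u) := by
    rw [secondDeriv_coe]
    simp only [hU]
    exact (contDiff_exp_mul β d1 d2 (continuous_liftPotDeriv2 hp hNc hNM)).2 u
  have hjump := jumpDual_exp_coe (p := p) (c := c) (β := β) hp hnc hVc hU u
  change |1 / 2 * secondDeriv (fun x => Real.exp (-β * U x)) (u : Torus) +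
    1 / α * jumpDual p c n (fun x => Real.exp (-β * U x)) (u : Torus)| ≤
    Real.exp (-β * U (u : Torus)) * K
  rw [hsec, hjump, hU]
  set JR := ∫ θ in 0..Real.pi, (Real.exp (-β * (V (u - c * θ ^ (p - 1)) - V u)) *
    N (u + θ - c * θ ^ (p - 1)) - N (u + θ)) with hJR
  set JL := ∫ θ in 0..Real.pi, (Real.exp (-β * (V (-(-u - c * θ ^ (p - 1))) - V (- -u))) *
    N (-(-u + θ - c * θ ^ (p - 1))) - N (-(-u + θ))) with hJL
  have hRL := (abs_add_le _ _).trans (add_le_add (R.trans err) (L.trans err))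
  have key : 1 / 2 * (Real.exp (-β * V u) * (β ^ 2 * V' u ^ 2 - β * V'' u)) +
      1 / α * (Real.exp (-β * V u) * ((2 * Real.pi)⁻¹ * (JR + JL))) =
      Real.exp (-β * V u) * ((2 * Real.pi * α)⁻¹ *
        ((JR + c * powAvgDeriv (p - 1) N u - β * V' u * (c * powAvg (p - 1) N u)) +
        (JL + c * powAvgDeriv (p - 1) (fun t => N (-t)) (-u) -
          β * -V' u * (c * powAvg (p - 1) (fun t => N (-t)) (-u))))) := by
    -- The cancellation rests on `c = p / (2 π) * (π β α)`: the first order terms of the jumps are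
    -- exact multiples of `V'` and `V''`.
    have e1 : c * (powAvg (p - 1) N u - powAvg (p - 1) (fun t => N (-t)) (-u)) =
        -(Real.pi * β * α) * V' u := by
      rw [hV', liftPotDeriv, hc]
      field_simp
    have e2 : c * (powAvgDeriv (p - 1) N u + powAvgDeriv (p - 1) (fun t => N (-t)) (-u)) =
        -(Real.pi * β * α) * V'' u := by
      rw [hV'', liftPotDeriv2, hc]
      field_simp
    have e3 : (JR + c * powAvgDeriv (p - 1) N u - β * V' u * (c * powAvg (p - 1) N u)) +
        (JL + c * powAvgDeriv (p - 1) (fun t => N (-t)) (-u) -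
          β * -V' u * (c * powAvg (p - 1) (fun t => N (-t)) (-u))) =
        JR + JL - Real.pi * β * α * V'' u + β ^ 2 * (Real.pi * α) * V' u ^ 2 := by
      linear_combination e2 - β * V' u * e1
    rw [e3]
    field_simp
    ring
  rw [key, abs_mul, abs_of_pos (Real.exp_pos _), abs_mul, abs_of_pos (by positivity)]
  refine mul_le_mul_of_nonneg_left ?_ (Real.exp_pos _).le
  refine (mul_le_mul_of_nonneg_left hRL (by positivity)).trans ?_
  have hK : 0 ≤ K := by
    have : 0 ≤ α * K := (abs_nonneg _).trans (R.trans err)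
    exact nonneg_of_mul_nonneg_right this hα
  rw [show (2 * Real.pi * α)⁻¹ * (α * K + α * K) = K / Real.pi by field_simp; ring]
  -- The two halves contribute `2 α K`, and the prefactor `1 / (2 π α)` leaves `K / π`.
  exact div_le_self hK (by linarith [Real.pi_gt_three])

/-! ### From a dual function to the Hilbert space adjoint. -/

theorem inner_real_L2 {μ : Measure Torus} (f g : Lp ℝ 2 μ) :
    inner ℝ f g = ∫ x, f x * g x ∂μ := by
  rw [L2.inner_def]
  refine integral_congr_ae (Filter.Eventually.of_forall fun x => ?_)
  simp [mul_comm]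

/-- If a bounded function `h` is dual to the generator against `C²` functions, then `1` is in the
domain of the adjoint, and the adjoint sends `1` to `h`. -/
theorem exists_adjoint_one_of_dual {p α β K : ℝ} {ν : Measure Torus} [IsProbabilityMeasure ν]
    (hβ : 0 ≤ β) {h : Torus → ℝ} (hm : Measurable h) (hK : ∀ x, |h x| ≤ K)
    (hdual : ∀ f : C2, ∫ x, h x * (f : C(Torus, ℝ)) x ∂gibbs p β ν =
      ∫ x, genFun p α β ν (f : C(Torus, ℝ)) x ∂gibbs p β ν) :
    ∃ hd : oneL2 p β ν ∈ (generator p α ν hβ).adjoint.domain,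
      Real.sqrt (∫ x, ((generator p α ν hβ).adjoint ⟨oneL2 p β ν, hd⟩ x) ^ 2 ∂gibbs p β ν) ≤ K := by
  have := isProbabilityMeasure_gibbs p ν hβ
  have hK0 : 0 ≤ K := (abs_nonneg _).trans (hK 0)
  have hLp : MemLp h 2 (gibbs p β ν) :=
    MemLp.of_bound hm.aestronglyMeasurable K (Filter.Eventually.of_forall hK)
  have hcoe : ∀ f : C2, toL2 p β ν f =ᵐ[gibbs p β ν] (f : C(Torus, ℝ)) := fun f =>
    ContinuousMap.coeFn_toLp (𝕜 := ℝ) (gibbs p β ν) (f : C(Torus, ℝ))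
  have hin : ∀ x : (generator p α ν hβ).domain,
      inner ℝ (hLp.toLp h) (x : Lp ℝ 2 (gibbs p β ν)) =
        inner ℝ (oneL2 p β ν) (generator p α ν hβ x) := by
    rintro ⟨_, f, rfl⟩
    rw [generator_apply, inner_real_L2, inner_real_L2]
    calc _ = ∫ x, h x * (f : C(Torus, ℝ)) x ∂gibbs p β ν := by
          refine integral_congr_ae ?_
          filter_upwards [hLp.coeFn_toLp, hcoe f] with x h1 h2
          rw [h1, h2]
      _ = ∫ x, genFun p α β ν (f : C(Torus, ℝ)) x ∂gibbs p β ν := hdual f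
      _ = _ := by
          refine integral_congr_ae ?_
          filter_upwards [(memLp_genFun p α β ν (gibbs p β ν) f).coeFn_toLp, hcoe 1] with x h1 h2
          rw [oneL2, h2]
          simpa [genL2] using h1.symm
  have hd := LinearPMap.mem_adjoint_domain_of_exists _ ⟨_, hin⟩
  refine ⟨hd, ?_⟩
  -- Density of the `C²` classes makes the adjoint unique, hence equal to the class of `h`.
  rw [LinearPMap.adjoint_apply_eq (dense_generator_domain p α ν hβ) ⟨oneL2 p β ν, hd⟩ hin]
  refine Real.sqrt_le_iff.2 ⟨hK0, ?_⟩
  have hb := norm_integral_le_of_norm_le_const (μ := gibbs p β ν) (C := K ^ 2)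
    (f := fun x => (hLp.toLp h x) ^ 2) (by
      filter_upwards [hLp.coeFn_toLp] with x hx
      rw [hx, norm_pow]
      exact pow_le_pow_left₀ (norm_nonneg _) (hK x) 2)
  rw [probReal_univ, mul_one] at hb
  exact (le_abs_self _).trans hb

theorem adjoint_one_bound {p a A α β : ℝ} (hp : 1 ≤ p) (ha : 0 < a) (ha1 : a ≤ 1) (hA : 0 ≤ A)
    (hα : 0 < α) (hβ : 1 ≤ β) (hβ0 : 0 ≤ β) (hαβ : α * β ^ 2 ≤ 1) (ν : Measure Torus)
    [IsProbabilityMeasure ν] (hν : HasHolderDensity ν a A) :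
    ∃ hd : oneL2 p β ν ∈ (generator p α ν hβ0).adjoint.domain,
      Real.sqrt (∫ x, ((generator p α ν hβ0).adjoint ⟨oneL2 p β ν, hd⟩ x) ^ 2 ∂gibbs p β ν) ≤
        adjointConst A (p / 2 * Real.pi ^ (p - 1)) (1 + A * Real.pi)
          (p * Real.pi ^ (p - 1) * (1 + A * Real.pi))
          (3 * p * Real.pi ^ (p - 1) * (1 + A * Real.pi)) * α ^ a * β ^ 4 := by
  obtain ⟨n, hn0, hn, hν⟩ := hν
  have hnc : Continuous n := continuous_of_lift (continuous_of_holder ha (lift_holder ha hA hn))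
  have hM : ∀ x, |n x| ≤ 1 + A * Real.pi := fun x => by
    rw [abs_of_nonneg (hn0 x)]
    exact density_le ha ha1 hA hn0 hn hnc hν x
  set N : ℝ → ℝ := fun t => n (t : Torus) with hNdef
  have hNc : Continuous N := hnc.comp (AddCircle.continuous_mk' _)
  have hNM : ∀ t, |N t| ≤ 1 + A * Real.pi := fun t => hM _
  have hper : Function.Periodic N (2 * Real.pi) := fun t => by simp [hNdef]
  have hU := potential_coe (p := p) (by linarith) hn0 hnc hν
  have hexp := (contDiff_exp_mul β (hasDerivAt_liftPot hp hNc hNM hper)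
    (hasDerivAt_liftPotDeriv hp hNc hNM) (continuous_liftPotDeriv2 hp hNc hNM)).1
  have hE : ContDiff ℝ 2 fun t : ℝ => Real.exp (-β * potential p ν (t : Torus)) := by
    simpa only [hU] using hexp
  -- The weight is itself of class `C²`, as a continuous density already gives a `C²` potential for
  -- every `p ≥ 1`; so the second derivative can be moved onto it.
  let E : C2 := ⟨⟨fun x => Real.exp (-β * potential p ν x), continuous_of_lift hE.continuous⟩, hE⟩
  have hbound := abs_adjoint_numerator_le hp ha ha1 hA hα hβ hαβ hn hM hU
  set J : Torus → ℝ := fun x =>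
    1 / 2 * secondDeriv (fun x => Real.exp (-β * potential p ν x)) x +
      1 / α * jumpDual p (p / 2 * β * α) n (fun x => Real.exp (-β * potential p ν x)) x with hJ
  have hJm : Measurable J := ((continuous_secondDeriv E).measurable.const_mul _).add
    ((measurable_jumpDual p _ hnc (E : C(Torus, ℝ)).continuous).const_mul _)
  have hEm : Measurable fun x => Real.exp (-β * potential p ν x) :=
    (E : C(Torus, ℝ)).continuous.measurable
  refine exists_adjoint_one_of_dual hβ0 (h := fun x =>
    (Real.exp (-β * potential p ν x))⁻¹ * J x) (hEm.inv.mul hJm) (fun x => ?_) (fun f => ?_)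
  · rw [abs_mul, abs_inv, abs_of_pos (Real.exp_pos _), inv_mul_le_iff₀ (Real.exp_pos _)]
    exact hbound x
  · have hd := integral_mul_genFun_eq (p := p) (α := α) (β := β) hn0 hnc hν E f
    rw [gibbs, integral_tilted, integral_tilted]
    simp only [smul_eq_mul]
    -- The normalization is the same constant factor on both sides, and the inverse weight in `h`
    -- cancels the Gibbs weight; what is left is duality for the uniform measure.
    set Z := ∫ x, Real.exp (-β * potential p ν x) ∂unif
    calc _ = ∫ x, Z⁻¹ * ((f : C(Torus, ℝ)) x * J x) ∂unif := by
          refine integral_congr_ae (Filter.Eventually.of_forall fun x => ?_)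
          have := (Real.exp_pos (-β * potential p ν x)).ne'
          simp only
          field_simp
      _ = ∫ x, Z⁻¹ * (Real.exp (-β * potential p ν x) *
            genFun p α β ν (f : C(Torus, ℝ)) x) ∂unif := by
          rw [integral_const_mul, integral_const_mul]
          congr 1
          exact hd.symm
      _ = _ := by
          refine integral_congr_ae (Filter.Eventually.of_forall fun x => ?_)
          simp only
          ring

end

end CircleMeans

/-! ### The theorem: choice of the constants. -/

theorem mainTheorem5 :
    ∀ p : ℝ, 1 ≤ p → ∃ σ : ℝ, 0 < σ ∧ σ < 1 / 2 ∧
      ∀ A : ℝ, 0 < A → ∃ C : ℝ, 0 < C ∧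
        ∀ a : ℝ, 0 < a → a ≤ 1 →
        ∀ (ν : MeasureTheory.Measure CircleMeans.Torus) [MeasureTheory.IsProbabilityMeasure ν],
        CircleMeans.HasHolderDensity ν a A →
        ∀ (α β : ℝ) (_ : 0 < α) (hβ : 1 < β) (_ : α * β ^ 2 < σ),
          ∃ h : CircleMeans.oneL2 p β ν ∈
              (CircleMeans.generator p α ν (zero_le_one.trans hβ.le)).adjoint.domain,
            Real.sqrt (∫ x, ((CircleMeans.generator p α ν (zero_le_one.trans hβ.le)).adjoint
                ⟨CircleMeans.oneL2 p β ν, h⟩ x) ^ 2 ∂(CircleMeans.gibbs p β ν))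
              ≤ C * α ^ CircleMeans.expo a p * β ^ 4 := by
  intro p hp
  -- The estimate needs only `α * β ^ 2 ≤ 1`, so any number in `(0, 1 / 2)` would do, for every `p`.
  refine ⟨1 / 4, by norm_num, by norm_num, fun A hA => ?_⟩
  have hC : 0 < CircleMeans.adjointConst A (p / 2 * Real.pi ^ (p - 1)) (1 + A * Real.pi)
      (p * Real.pi ^ (p - 1) * (1 + A * Real.pi))
      (3 * p * Real.pi ^ (p - 1) * (1 + A * Real.pi)) := by
    unfold CircleMeans.adjointConst
    positivity
  refine ⟨_, hC, fun a ha ha1 ν _ hν α β hα hβ hαβ => ?_⟩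
  obtain ⟨hd, hle⟩ := CircleMeans.adjoint_one_bound hp ha ha1 hA.le hα hβ.le
    (zero_le_one.trans hβ.le) (by linarith) ν hν
  refine ⟨hd, hle.trans ?_⟩
  have hα1 : α ≤ 1 := by nlinarith [one_le_pow₀ hβ.le (n := 2)]
  -- Since `α ≤ 1`, the bound with the larger exponent `a` is the stronger one.
  have hexpo : CircleMeans.expo a p ≤ a := by
    unfold CircleMeans.expo
    split_ifs
    · exact min_le_left _ _
    · exact le_rfl
  exact mul_le_mul_of_nonneg_right (mul_le_mul_of_nonneg_left
    (Real.rpow_le_rpow_of_exponent_ge hα hα1 hexpo) hC.le) (by positivity)
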